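/- **Setting.** Identify $\mathbb C\cong\mathbb R^2$, let $Q=(0,1)\times(0,1)\subset\mathbb C$, $\Lambda=\mathbb Z+i\mathbb Z$, $m_1=\mathrm{Re}\,m$, $m_2=\mathrm{Im}\,m$ for $m\in\Lambda$, and $\mathbf Q=[-\pi,\pi]^2$. Let $\varpi\subset Q$ be a domain such that $\partial Q\subset\partial\varpi$ and $Q\setminus\mathrm{cl}(\varpi)$ contains a nonempty open set. Put $\varpi_m=\varpi+m$ and let $\Omega$ be the interior of $\bigcup_{m\in\Lambda}\mathrm{cl}(\varpi_m)$. Assume that the set $\Omega\setminus\bigcup_{m}\varpi_m$ has zero area. Write $[x]$ for the integer part of $x\in\mathbb R$, $[z]=([\mathrm{Re}\,z],[\mathrm{Im}\,z])$, $z^{\mathsf{tr}}=z-[\mathrm{Re}\,z]-i[\mathrm{Im}\,z]$, and $\eta\cdot(a,b)=\eta_1a+\eta_2b$. **Assumption $(\mathcal A)$.** There are meromorphic functions $\varphi,\phi$ on $\mathbb C$ such that $\varphi(z)=\varphi(z+1)=\varphi(z+i)$; $\varphi$ has no zeros in $\mathrm{cl}(\Omega)$ (in particular $\varphi\not\equiv0$);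 $\phi$ has only finitely many poles, all in $Q$; $\varphi(z)=\sum_{m\in\Lambda}\phi(z-m)$ for all $z\in\Omega$ that are not poles of any $\phi(\cdot-m)$; and $\sup_{z\in\Omega\setminus\mathrm{cl}(Q)}(1+|z|)^b|\phi(z)|<\infty$ for some $b>2$. **Spaces and operators.** $A^2(D)\subset L^2(D)$ is the Bergman space of an open set $D$ (area measure), whose elements are evaluated pointwise through their analytic representatives. $P_\Omega$ is the orthogonal projection of $L^2(\Omega)$ onto $A^2(\Omega)$, and $K_\Omega$ is the Bergman kernel (the reproducing kernel of $A^2(\Omega)$). For $\eta\in\mathbf Q$, $A^2_{\eta,\mathrm{ext}}(\varpi)$ is the space of those $f\in A^2(\varpi)$ that extend analytically to a neighbourhood of $\mathrm{cl}(\varpi)\cap\Omega$ in $\Omega$ and satisfy $f(1+iy)=e^{i\eta_1}f(iy)$ and $f(x+i)=e^{i\eta_2}f(x)$ for all $x,y\in(0,1)$ with $iy\in\Omega$, respectively $x\in\Omega$; $A^2_\eta(\varpi)$ is its closure in $L^2(\varpi)$, $P_\eta$ is the orthogonal projection of $L^2(\varpi)$ onto $A^2_\eta(\varpi)$, and $K_\eta(z,w)$,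 $z,w\in\varpi$, is the reproducing kernel of $A^2_\eta(\varpi)$. $L^2(\mathbf Q;A^2_\eta(\varpi))$ is the subspace of the Bochner space $L^2(\mathbf Q;L^2(\varpi))$ of functions $g$ with $g(\cdot,\eta)\in A^2_\eta(\varpi)$ for a.e. $\eta$, and $(\mathcal P g)(\cdot,\eta)=P_\eta(g(\cdot,\eta))$. The Floquet transform $\mathsf F:L^2(\Omega)\to L^2(\mathbf Q;L^2(\varpi))$ and the operator $\mathsf F^{-1}$ are $$\mathsf Ff(z,\eta)=\widehat f(z,\eta)=\frac1{2\pi}\sum_{m\in\Lambda}e^{-i\eta_1m_1-i\eta_2m_2}f(z+m),\qquad \mathsf F^{-1}g(z)=\frac1{2\pi}\int_{\mathbf Q}e^{i\eta\cdot[z]}g(z^{\mathsf{tr}},\eta)\,d\eta,$$ where the series converges in $L^2(\mathbf Q;L^2(\varpi))$ and the integral is, on each $\varpi_m$, an $L^2(\varpi)$-valued Bochner integral. **Theorem.** Under the above assumptions: (i) $\mathcal P$ is well defined on $L^2(\mathbf Q;L^2(\varpi))$ (for every $g$ in this space, $\eta\mapsto P_\eta(g(\cdot,\eta))$ is measurable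 and square integrable), and $\mathcal P$ is the orthogonal projection of $L^2(\mathbf Q;L^2(\varpi))$ onto $L^2(\mathbf Q;A^2_\eta(\varpi))$. For all $\eta\in\mathbf Q$ and $z\in\varpi$, $K_\eta(z,\cdot)\in L^2(\varpi)$ and $P_\eta f(z)=\int_\varpi K_\eta(z,w)f(w)\,dA(w)$ for every $f\in L^2(\varpi)$. (ii) For every $f\in L^2(\Omega)$ one has $\mathsf F P_\Omega f=\mathcal P\mathsf F f$ and $P_\Omega f=\mathsf F^{-1}\mathcal P\mathsf Ff$ a.e. in $\Omega$. Moreover, for every $z\in\Omega$ with $z^{\mathsf{tr}}\in\varpi$ (hence for a.e. $z\in\Omega$), $$P_\Omega f(z)=\frac1{2\pi}\int_{\mathbf Q}e^{i\eta\cdot[z]}\big(P_\eta\widehat f(\cdot,\eta)\big)(z^{\mathsf{tr}})\,d\eta=\frac1{4\pi^2}\int_\Omega\int_{\mathbf Q}e^{i\eta\cdot([z]-[w])}K_\eta(z^{\mathsf{tr}},w^{\mathsf{tr}})f(w)\,d\eta\,dA(w),$$ where the first integrand is integrable and, in the iterated integral, the integral over $\eta$ is taken first. For all $z,w\in\Omega$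 with $z^{\mathsf{tr}},w^{\mathsf{tr}}\in\varpi$ the function $\eta\mapsto K_\eta(z^{\mathsf{tr}},w^{\mathsf{tr}})$ is integrable over $\mathbf Q$ and $$K_\Omega(z,w)=\frac1{4\pi^2}\int_{\mathbf Q}e^{i\eta\cdot([z]-[w])}K_\eta(z^{\mathsf{tr}},w^{\mathsf{tr}})\,d\eta,$$ and for each such $z$ the right-hand side, as a function of $w$, belongs to $L^2(\Omega)$. -/

import Mathlib

open MeasureTheory Filter Topology Set
open scoped ENNReal

noncomputable section

namespace FloquetBergman

/-! ## Periodic cell and periodic domain -/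

/-- The open unit square `(0,1) × (0,1)`, as a subset of `ℂ`. -/
def unitSquare : Set ℂ := {z | z.re ∈ Ioo (0 : ℝ) 1 ∧ z.im ∈ Ioo (0 : ℝ) 1}

/-- The lattice point `m₁ + i m₂`. -/
def lat (m : ℤ × ℤ) : ℂ := ⟨m.1, m.2⟩

/-- The translate `A + (m₁ + i m₂)`. -/
def cellTranslate (A : Set ℂ) (m : ℤ × ℤ) : Set ℂ := (fun z => z + lat m) '' A

/-- `ϖ` is a periodic cell: a domain in the open unit square whose boundary contains the boundary
of the square and such that the complement of its closure in the square contains a (nonempty)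
open set. -/
structure IsPeriodicCell (ϖ : Set ℂ) : Prop where
  isOpen : IsOpen ϖ
  isConnected : IsConnected ϖ
  subset_unitSquare : ϖ ⊆ unitSquare
  frontier_subset : frontier unitSquare ⊆ frontier ϖ
  exists_hole : ∃ U : Set ℂ, IsOpen U ∧ U.Nonempty ∧ U ⊆ unitSquare \ closure ϖ

/-- The doubly periodic domain generated by the cell `ϖ`: the interior of the union of the closures
of all the translates of `ϖ`. -/
def periodicDomain (ϖ : Set ℂ) : Set ℂ := interior (⋃ m : ℤ × ℤ, closure (cellTranslate ϖ m))

theorem isOpen_periodicDomain (ϖ : Set ℂ) : IsOpen (periodicDomain ϖ) := isOpen_interior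

/-- The set of poles of a meromorphic function. -/
def poles (f : ℂ → ℂ) : Set ℂ := {z | meromorphicOrderAt f z < 0}

/-- Condition `(𝒜)`. Meromorphic functions are functions `ℂ → ℂ` in normal form: analytic
except at their poles, where by convention they take the value `0`. The series is only required to
represent `Φ` at points of the periodic domain that are not poles of one of its terms. -/
def ConditionA (ϖ : Set ℂ) : Prop :=
  ∃ Φ φ : ℂ → ℂ,
    -- `Φ` is an elliptic function with periods `1` and `i`
    MeromorphicNFOn Φ univ ∧ (∀ z, Φ (z + 1) = Φ z) ∧ (∀ z, Φ (z + Complex.I) = Φ z) ∧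
    -- `Φ` has no zeros in the closure of the periodic domain
    (∀ z ∈ closure (periodicDomain ϖ), meromorphicOrderAt Φ z ≤ 0) ∧
    -- `φ` is meromorphic, with finitely many poles, all of them in the open unit square
    MeromorphicNFOn φ univ ∧ (poles φ).Finite ∧ poles φ ⊆ unitSquare ∧
    (∀ z ∈ periodicDomain ϖ, (∀ m, z - lat m ∉ poles φ) →
      HasSum (fun m : ℤ × ℤ => φ (z - lat m)) (Φ z)) ∧
    ∃ b d : ℝ, 2 < b ∧ ∀ z ∈ periodicDomain ϖ \ closure unitSquare, (1 + ‖z‖) ^ b * ‖φ z‖ ≤ d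

/-! ## Bergman spaces, Bergman projections, reproducing kernels -/

/-- `L²(D)` with respect to the area measure. -/
abbrev L2 (D : Set ℂ) : Type := Lp ℂ 2 (volume.restrict D)

/-- Sub-mean value inequality for `|f|²` over a disc (with a non-optimal constant). -/
theorem area_sub_mean {f : ℂ → ℂ} {c : ℂ} {R : ℝ} (hR : 0 < R)
    (hf : DifferentiableOn ℂ f (Metric.ball c R)) :
    ENNReal.ofReal (R ^ 2 / 2) * ‖f c‖ₑ ^ 2 ≤ ∫⁻ w in Metric.ball c R, ‖f w‖ₑ ^ 2 := by
  have hcirc : ∀ r ∈ Ioo 0 R, ‖f c‖ₑ ^ 2 ≤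
      ∫⁻ θ in Ioo (-Real.pi) Real.pi, ‖f (c + r * (Real.cos θ + Real.sin θ * Complex.I))‖ₑ ^ 2 := by
    intro r hr
    have hd : DiffContOnCl ℂ (fun z => f z ^ 2) (Metric.ball c |r|) := by
      have : DifferentiableOn ℂ (fun z => f z ^ 2) (Metric.ball c R) := hf.pow 2
      rw [abs_of_pos hr.1]
      apply DifferentiableOn.diffContOnCl
      apply this.mono
      rw [closure_ball _ hr.1.ne']
      exact Metric.closedBall_subset_ball hr.2
    have h1 := hd.circleAverage
    have hper : Function.Periodic (fun θ => f (circleMap c r θ) ^ 2) (2 * Real.pi) := by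
      intro θ
      simp only [periodic_circleMap c r θ]
    rw [Real.circleAverage_def] at h1
    have h2 := hper.intervalIntegral_add_eq 0 (-Real.pi)
    rw [zero_add, show -Real.pi + 2 * Real.pi = Real.pi by ring] at h2
    rw [h2, intervalIntegral.integral_of_le (by linarith [Real.pi_pos]),
      integral_Ioc_eq_integral_Ioo] at h1
    have h3 : ‖f c‖ₑ ^ 2 = ‖f c ^ 2‖ₑ := by simp [enorm_pow]
    rw [h3, ← h1]
    calc ‖(2 * Real.pi)⁻¹ • ∫ θ in Ioo (-Real.pi) Real.pi, f (circleMap c r θ) ^ 2‖ₑ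
        ≤ 1 * ‖∫ θ in Ioo (-Real.pi) Real.pi, f (circleMap c r θ) ^ 2‖ₑ := by
          rw [enorm_smul]
          gcongr
          rw [Real.enorm_eq_ofReal (by positivity)]
          rw [ENNReal.ofReal_le_one]
          apply inv_le_one_of_one_le₀
          linarith [Real.pi_gt_three]
      _ ≤ ∫⁻ θ in Ioo (-Real.pi) Real.pi, ‖f (circleMap c r θ) ^ 2‖ₑ := by
          rw [one_mul]; exact enorm_integral_le_lintegral_enorm _
      _ = _ := by
          refine lintegral_congr fun θ => ?_
          rw [enorm_pow, circleMap, Complex.exp_mul_I]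
          simp
  set F : ℂ → ℝ≥0∞ := fun w => (Metric.ball c R).indicator (fun w => ‖f w‖ₑ ^ 2) (c + w) with hF
  have e1 : ∫⁻ w in Metric.ball c R, ‖f w‖ₑ ^ 2 = ∫⁻ w, F w := by
    rw [← lintegral_indicator Metric.isOpen_ball.measurableSet, hF,
      lintegral_add_left_eq_self (fun w => (Metric.ball c R).indicator (fun w => ‖f w‖ₑ ^ 2) w) c]
  have hFm : Measurable F := by
    have hm : Measurable ((Metric.ball c R).indicator (fun w => ‖f w‖ₑ ^ 2)) := by
      have hc : ContinuousOn (fun w => ‖f w‖ₑ ^ 2) (Metric.ball c R) := by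
        have := hf.continuousOn.enorm
        exact (ENNReal.continuous_pow 2).comp_continuousOn this
      classical
      have := hc.measurable_piecewise (g := 0) continuousOn_const
        Metric.isOpen_ball.measurableSet
      rwa [Set.piecewise_eq_indicator] at this
    exact hm.comp (measurable_const_add c)
  rw [e1, ← Complex.lintegral_comp_polarCoord_symm]
  have hsub : Ioo 0 R ×ˢ Ioo (-Real.pi) Real.pi ⊆ polarCoord.target := by
    rw [polarCoord_target]
    exact prod_mono Ioo_subset_Ioi_self subset_rfl
  refine le_trans ?_ (lintegral_mono_set hsub)
  rw [Measure.volume_eq_prod, ← Measure.prod_restrict]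
  have hmeas : Measurable fun p : ℝ × ℝ => ENNReal.ofReal p.1 • F (Complex.polarCoord.symm p) := by
    simp only [smul_eq_mul]
    refine Measurable.mul (by fun_prop) (hFm.comp ?_)
    have : (fun p : ℝ × ℝ => Complex.polarCoord.symm p) =
      fun p : ℝ × ℝ => (p.1 * (Real.cos p.2 + Real.sin p.2 * Complex.I) : ℂ) := by
      funext p; exact Complex.polarCoord_symm_apply p
    change Measurable fun p : ℝ × ℝ => Complex.polarCoord.symm p
    rw [this]; fun_prop
  rw [lintegral_prod _ hmeas.aemeasurable]
  have hin : ∀ r ∈ Ioo 0 R, ENNReal.ofReal r * ‖f c‖ₑ ^ 2 ≤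
      ∫⁻ θ in Ioo (-Real.pi) Real.pi, ENNReal.ofReal r • F (Complex.polarCoord.symm (r, θ)) := by
    intro r hr
    simp only [smul_eq_mul]
    rw [lintegral_const_mul' _ _ ENNReal.ofReal_ne_top]
    gcongr
    refine (hcirc r hr).trans (le_of_eq ?_)
    refine lintegral_congr fun θ => ?_
    simp only [hF, Complex.polarCoord_symm_apply]
    rw [indicator_of_mem]
    rw [Complex.ofReal_cos, Complex.ofReal_sin, ← Complex.exp_mul_I]
    simp [Complex.norm_exp_ofReal_mul_I, abs_of_pos hr.1, hr.2]
  refine le_trans (le_of_eq ?_) (setLIntegral_mono' measurableSet_Ioo hin)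
  rw [lintegral_mul_const' _ _ (by simp)]
  congr 1
  rw [← ofReal_integral_eq_lintegral_ofReal]
  · rw [← integral_Ioc_eq_integral_Ioo, ← intervalIntegral.integral_of_le hR.le, integral_id]
    simp
  · exact (continuous_id.integrableOn_Icc (a := 0) (b := R)).mono_set Ioo_subset_Icc_self
  · filter_upwards [ae_restrict_mem measurableSet_Ioo] with r hr using hr.1.le

/-- The square integrable holomorphic functions form a closed subspace. -/
theorem isClosed_bergman {D : Set ℂ} (hD : IsOpen D) :
    IsClosed {f : Lp ℂ 2 (volume.restrict D) |
      ∃ g : ℂ → ℂ, DifferentiableOn ℂ g D ∧ f =ᵐ[volume.restrict D] g} := by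
  refine IsSeqClosed.isClosed fun u f hu hf => ?_
  choose g hg hug using hu
  -- the holomorphic representatives are locally uniformly Cauchy
  have hest : ∀ c R, 0 < R → Metric.ball c R ⊆ D → ∀ m n,
      ENNReal.ofReal (R ^ 2 / 2) * ‖g m c - g n c‖ₑ ^ 2 ≤ ENNReal.ofReal (dist (u m) (u n)) ^ 2 := by
    intro c R hR hcR m n
    refine (area_sub_mean hR (((hg m).sub (hg n)).mono hcR)).trans ?_
    refine (lintegral_mono_set hcR).trans (le_of_eq ?_)
    rw [← edist_dist, Lp.edist_def, eLpNorm_eq_lintegral_rpow_enorm_toReal (by simp) (by simp)]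
    simp only [ENNReal.toReal_ofNat, ENNReal.rpow_ofNat]
    rw [← ENNReal.rpow_natCast, ← ENNReal.rpow_mul]
    norm_num
    refine lintegral_congr_ae ?_
    filter_upwards [hug m, hug n] with w h1 h2
    simp [h1, h2]
  have hloc : ∀ x ∈ D, ∃ r > 0, Metric.ball x r ⊆ D ∧ UniformCauchySeqOn g atTop (Metric.ball x r) := by
    intro x hx
    obtain ⟨R, hR, hxR⟩ := Metric.isOpen_iff.1 hD x hx
    refine ⟨R / 2, by positivity, (Metric.ball_subset_ball (by linarith)).trans hxR, ?_⟩
    rw [Metric.uniformCauchySeqOn_iff]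
    intro ε hε
    obtain ⟨N, hN⟩ := Metric.cauchySeq_iff.1 hf.cauchySeq (ε * (R / 4)) (by positivity)
    refine ⟨N, fun m hm n hn c hc => ?_⟩
    have h1 := hest c (R / 2) (by positivity) (by
      intro y hy
      apply hxR
      rw [Metric.mem_ball] at *
      linarith [dist_triangle y c x]) m n
    have h2 : (R / 2) ^ 2 / 2 * dist (g m c) (g n c) ^ 2 ≤ dist (u m) (u n) ^ 2 := by
      rw [← ofReal_norm, ← dist_eq_norm, ← ENNReal.ofReal_pow dist_nonneg,
        ← ENNReal.ofReal_pow dist_nonneg, ← ENNReal.ofReal_mul (by positivity)] at h1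
      exact (ENNReal.ofReal_le_ofReal_iff (by positivity)).1 h1
    have h3 := hN m hm n hn
    have h4 : dist (u m) (u n) ^ 2 < (ε * (R / 4)) ^ 2 := by
      gcongr
    by_contra! h5
    have h6 : ε ^ 2 ≤ dist (g m c) (g n c) ^ 2 := by gcongr
    have h7 : (R / 2) ^ 2 / 2 * ε ^ 2 ≤ (R / 2) ^ 2 / 2 * dist (g m c) (g n c) ^ 2 := by gcongr
    nlinarith [sq_nonneg (R * ε)]
  have hpt : ∀ x, ∃ y, x ∈ D → Tendsto (fun n => g n x) atTop (𝓝 y) := by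
    intro x
    by_cases hx : x ∈ D
    · obtain ⟨r, hr, -, hc⟩ := hloc x hx
      obtain ⟨y, hy⟩ := cauchySeq_tendsto_of_complete (hc.cauchySeq (Metric.mem_ball_self hr))
      exact ⟨y, fun _ => hy⟩
    · exact ⟨0, fun h => absurd h hx⟩
  choose G hG using hpt
  have hlu : TendstoLocallyUniformlyOn g G atTop D := by
    rw [Metric.tendstoLocallyUniformlyOn_iff]
    intro ε hε x hx
    obtain ⟨r, hr, hrD, hc⟩ := hloc x hx
    refine ⟨Metric.ball x r, mem_nhdsWithin_of_mem_nhds (Metric.ball_mem_nhds x hr), ?_⟩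
    exact Metric.tendstoUniformlyOn_iff.1
      (hc.tendstoUniformlyOn_of_tendsto fun y hy => hG y (hrD hy)) ε hε
  refine ⟨G, hlu.differentiableOn (Eventually.of_forall hg) hD, ?_⟩
  obtain ⟨ns, hns, hae⟩ := (tendstoInMeasure_of_tendsto_Lp hf).exists_seq_tendsto_ae
  have hall : ∀ᵐ w ∂(volume.restrict D), ∀ n, u n w = g n w := ae_all_iff.2 hug
  filter_upwards [hae, hall, ae_restrict_mem hD.measurableSet] with w h1 h2 h3
  refine tendsto_nhds_unique h1 ?_
  simp only [h2]
  exact (hG w h3).comp hns.tendsto_atTop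

/-- Fibrewise membership in closed sets is a closed condition in the Bochner space. -/
theorem isClosed_fiber {α E : Type*} [MeasurableSpace α] {μ : Measure α} [NormedAddCommGroup E]
    {K : α → Set E} (hK : ∀ a, IsClosed (K a)) :
    IsClosed {f : Lp E 2 μ | ∀ᵐ a ∂μ, f a ∈ K a} := by
  refine IsSeqClosed.isClosed fun u f hu hf => ?_
  obtain ⟨ns, -, hae⟩ := (tendstoInMeasure_of_tendsto_Lp hf).exists_seq_tendsto_ae
  have hall : ∀ᵐ a ∂μ, ∀ n, u n a ∈ K a := ae_all_iff.2 hu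
  filter_upwards [hae, hall] with a h1 h2
  exact (hK a).mem_of_tendsto h1 (Eventually.of_forall fun n => h2 _)

/-- The Bergman space `A²(D)` of an open set `D`, as a subspace of `L²(D)`. -/
def bergmanSpace (D : Set ℂ) : Submodule ℂ (L2 D) where
  carrier := {f | ∃ g : ℂ → ℂ, DifferentiableOn ℂ g D ∧ f =ᵐ[volume.restrict D] g}
  zero_mem' := ⟨0, differentiableOn_const 0, Lp.coeFn_zero _ _ _⟩
  add_mem' := by
    rintro f₁ f₂ ⟨g₁, h₁, e₁⟩ ⟨g₂, h₂, e₂⟩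
    exact ⟨g₁ + g₂, h₁.add h₂, (Lp.coeFn_add f₁ f₂).trans (e₁.add e₂)⟩
  smul_mem' := by
    rintro c f ⟨g, h, e⟩
    exact ⟨c • g, h.const_smul c, (Lp.coeFn_smul c f).trans (e.const_smul c)⟩

theorem hasOrthogonalProjection_bergmanSpace {D : Set ℂ} (hD : IsOpen D) :
    (bergmanSpace D).HasOrthogonalProjection := by
  have : CompleteSpace (bergmanSpace D) := (isClosed_bergman hD).isComplete.completeSpace_coe
  infer_instance

/-- The Bergman projection: the orthogonal projection of `L²(D)` onto `A²(D)`, `D` open. -/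
def bergmanProj (D : Set ℂ) (hD : IsOpen D) : L2 D →L[ℂ] L2 D :=
  haveI := hasOrthogonalProjection_bergmanSpace hD
  (bergmanSpace D).starProjection

open Classical in
/-- The pointwise values `f(z)`, `z ∈ D`, of an element `f` of `A²(D)`: the values of its holomorphic
representative, which is unique on the open set `D`. (Set to `0` off `D`, and for `f ∉ A²(D)`.) -/
def holoRep (D : Set ℂ) (f : L2 D) : ℂ → ℂ :=
  if h : ∃ g : ℂ → ℂ, DifferentiableOn ℂ g D ∧ f =ᵐ[volume.restrict D] g then D.indicator h.choose
  else 0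

open Classical in
/-- The Riesz representative in `K` of the evaluation `f ↦ f(z)` on a subspace `K` of
`A²(D)`; it is unique. (Set to `0` if there is none.) -/
def evalVec {D : Set ℂ} (K : Submodule ℂ (L2 D)) (z : ℂ) : L2 D :=
  if h : ∃ k ∈ K, ∀ f ∈ K, inner ℂ k f = holoRep D f z then h.choose else 0

/-- The reproducing kernel `K(z,w)`, `z, w ∈ D`, of a closed subspace of `A²(D)`: the function
`K(z,·)` is the complex conjugate of the Riesz representative of the evaluation at `z`, so that
`∫ K(z,w) f(w) dA(w)` is the value at `z` of the orthogonal projection of `f`. -/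
def reproKernel {D : Set ℂ} (K : Submodule ℂ (L2 D)) (z w : ℂ) : ℂ :=
  starRingEnd ℂ (holoRep D (evalVec K z) w)

/-! ## Quasiperiodic Bergman spaces on the cell -/

/-- The space `A²_{η,ext}(ϖ)` of the functions in `A²(ϖ)` that extend analytically to a
neighbourhood `V` of `cl(ϖ) ∩ Ω` in `Ω` and satisfy the quasiperiodic boundary conditions (on the
part of the boundary of the square that lies in `Ω`, where the extension is defined). -/
def quasiExt (ϖ : Set ℂ) (η : ℝ × ℝ) : Submodule ℂ (L2 ϖ) where
  carrier := {f | f ∈ bergmanSpace ϖ ∧ ∃ (V : Set ℂ) (g : ℂ → ℂ), IsOpen V ∧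
    closure ϖ ∩ periodicDomain ϖ ⊆ V ∧ V ⊆ periodicDomain ϖ ∧
    DifferentiableOn ℂ g V ∧ f =ᵐ[volume.restrict ϖ] g ∧
    (∀ y ∈ Ioo (0 : ℝ) 1, (y * Complex.I : ℂ) ∈ periodicDomain ϖ →
      g (1 + y * Complex.I) = Complex.exp (Complex.I * η.1) * g (y * Complex.I)) ∧
    (∀ x ∈ Ioo (0 : ℝ) 1, (x : ℂ) ∈ periodicDomain ϖ →
      g (x + Complex.I) = Complex.exp (Complex.I * η.2) * g x)}
  zero_mem' := ⟨zero_mem _, periodicDomain ϖ, 0, isOpen_periodicDomain ϖ, inter_subset_right,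
    subset_rfl, differentiableOn_const 0, Lp.coeFn_zero _ _ _, by simp, by simp⟩
  add_mem' := by
    rintro f₁ f₂ ⟨b₁, V₁, g₁, o₁, s₁, t₁, d₁, e₁, p₁, q₁⟩ ⟨b₂, V₂, g₂, o₂, s₂, t₂, d₂, e₂, p₂, q₂⟩
    refine ⟨add_mem b₁ b₂, V₁ ∩ V₂, g₁ + g₂, o₁.inter o₂, subset_inter s₁ s₂,
      inter_subset_left.trans t₁, (d₁.mono inter_subset_left).add (d₂.mono inter_subset_right),
      (Lp.coeFn_add f₁ f₂).trans (e₁.add e₂), fun y hy h => ?_, fun x hx h => ?_⟩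
    · simp only [Pi.add_apply, p₁ y hy h, p₂ y hy h, mul_add]
    · simp only [Pi.add_apply, q₁ x hx h, q₂ x hx h, mul_add]
  smul_mem' := by
    rintro c f ⟨b, V, g, o, s, t, d, e, p, q⟩
    refine ⟨Submodule.smul_mem _ c b, V, c • g, o, s, t, d.const_smul c,
      (Lp.coeFn_smul c f).trans (e.const_smul c), fun y hy h => ?_, fun x hx h => ?_⟩
    · simp only [Pi.smul_apply, p y hy h, smul_eq_mul]; ring
    · simp only [Pi.smul_apply, q x hx h, smul_eq_mul]; ring

/-- The space `A²_η(ϖ)`, the closure of `A²_{η,ext}(ϖ)`. -/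
def quasiSpace (ϖ : Set ℂ) (η : ℝ × ℝ) : Submodule ℂ (L2 ϖ) := (quasiExt ϖ η).topologicalClosure

instance (ϖ : Set ℂ) (η : ℝ × ℝ) : CompleteSpace (quasiSpace ϖ η) :=
  inferInstanceAs (CompleteSpace (quasiExt ϖ η).topologicalClosure)

/-- `P_η`, the orthogonal projection of `L²(ϖ)` onto `A²_η(ϖ)`. -/
def cellProj (ϖ : Set ℂ) (η : ℝ × ℝ) : L2 ϖ →L[ℂ] L2 ϖ := (quasiSpace ϖ η).starProjection

/-- `K_η`, the kernel of `P_η`. -/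
def cellKernel (ϖ : Set ℂ) (η : ℝ × ℝ) (z w : ℂ) : ℂ := reproKernel (quasiSpace ϖ η) z w

/-! ## Bochner spaces over the Floquet parameter -/

/-- The set `𝐐 = [-π, π]²` of Floquet parameters. -/
def floquetSquare : Set (ℝ × ℝ) := Icc (-Real.pi) Real.pi ×ˢ Icc (-Real.pi) Real.pi

/-- Lebesgue measure on `𝐐`. -/
def floquetMeasure : Measure (ℝ × ℝ) := volume.restrict floquetSquare

instance : IsFiniteMeasure floquetMeasure :=
  isFiniteMeasure_restrict.2 (isCompact_Icc.prod isCompact_Icc).measure_lt_top.ne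

/-- The Bochner space `L²(𝐐; L²(ϖ))`. -/
abbrev BochnerL2 (ϖ : Set ℂ) : Type := Lp (L2 ϖ) 2 floquetMeasure

/-- `L²(𝐐; A²_η(ϖ))`: the functions with `g(·, η) ∈ A²_η(ϖ)` for almost every `η ∈ 𝐐`. -/
def fiberSpace (ϖ : Set ℂ) : Submodule ℂ (BochnerL2 ϖ) where
  carrier := {g | ∀ᵐ η ∂floquetMeasure, g η ∈ quasiSpace ϖ η}
  zero_mem' := by
    filter_upwards [Lp.coeFn_zero (L2 ϖ) 2 floquetMeasure] with η h
    rw [h]; exact zero_mem _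
  add_mem' := by
    intro g₁ g₂ h₁ h₂
    filter_upwards [h₁, h₂, Lp.coeFn_add g₁ g₂] with η a b h
    rw [h]; exact add_mem a b
  smul_mem' := by
    intro c g h₁
    filter_upwards [h₁, Lp.coeFn_smul c g] with η a h
    rw [h]; exact Submodule.smul_mem _ c a

instance (ϖ : Set ℂ) : CompleteSpace (fiberSpace ϖ) :=
  (isClosed_fiber (K := fun η => (quasiSpace ϖ η : Set (L2 ϖ)))
    fun _ => Submodule.isClosed_topologicalClosure _).isComplete.completeSpace_coe

open Classical in
/-- The fibrewise operator `(𝒫 g)(·, η) = P_η (g(·, η))` (set to `0` if the right-hand side is not a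
square integrable function of `η`). -/
def fiberProj (ϖ : Set ℂ) (g : BochnerL2 ϖ) : BochnerL2 ϖ :=
  if h : MemLp (fun η => cellProj ϖ η (g η)) 2 floquetMeasure then h.toLp else 0

/-! ## Floquet transform -/

/-- The pairing `m₁ η₁ + m₂ η₂`. -/
def pairing (m : ℤ × ℤ) (η : ℝ × ℝ) : ℝ := m.1 * η.1 + m.2 * η.2

theorem memLp_cellPart (ϖ : Set ℂ) (m : ℤ × ℤ) (f : L2 (periodicDomain ϖ)) :
    MemLp (fun z => (periodicDomain ϖ).indicator f (z + lat m)) 2 (volume.restrict ϖ) := by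
  have h : MemLp ((periodicDomain ϖ).indicator f) 2 volume :=
    (memLp_indicator_iff_restrict (isOpen_periodicDomain ϖ).measurableSet).2 (Lp.memLp f)
  exact (h.comp_measurePreserving (measurePreserving_add_right volume (lat m))).restrict ϖ

/-- The function `z ↦ f(z + m)` on the cell `ϖ`, for `f ∈ L²(Ω)`. -/
def cellPart (ϖ : Set ℂ) (m : ℤ × ℤ) (f : L2 (periodicDomain ϖ)) : L2 ϖ := (memLp_cellPart ϖ m f).toLp

theorem memLp_mode (ϖ : Set ℂ) (m : ℤ × ℤ) (h : L2 ϖ) :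
    MemLp (fun η => Complex.exp (-(Complex.I * pairing m η)) • h) 2 floquetMeasure := by
  refine MemLp.of_bound (C := ‖h‖) ?_ (Eventually.of_forall fun η => ?_)
  · refine Continuous.aestronglyMeasurable ?_
    unfold pairing
    fun_prop
  · rw [norm_smul, Complex.norm_exp]; simp

/-- The Floquet transform `F : L²(Ω) → L²(𝐐; L²(ϖ))`,
`(F f)(z, η) = (2π)⁻¹ ∑ₘ exp(-i(η₁m₁ + η₂m₂)) f(z + m)`, where the series converges in the Bochner
space. -/
def floquet (ϖ : Set ℂ) (f : L2 (periodicDomain ϖ)) : BochnerL2 ϖ :=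
  (1 / (2 * Real.pi) : ℂ) • ∑' m : ℤ × ℤ, (memLp_mode ϖ m (cellPart ϖ m f)).toLp

/-- The integer parts `([Re z], [Im z])`. -/
def intPart (z : ℂ) : ℤ × ℤ := (⌊z.re⌋, ⌊z.im⌋)

/-- `z^tr = z - [Re z] - i [Im z]`. -/
def tr (z : ℂ) : ℂ := z - lat (intPart z)

/-- The inverse Floquet transform
`(F⁻¹ g)(z) = (2π)⁻¹ ∫_𝐐 exp(i([Re z]η₁ + [Im z]η₂)) g(z^tr, η) dη`. For each of the countably many
values of `([Re z], [Im z])` the integral is a Bochner integral with values in `L²(ϖ)`; hence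
`F⁻¹ g` is determined up to null sets. -/
def floquetInv (ϖ : Set ℂ) (g : BochnerL2 ϖ) (z : ℂ) : ℂ :=
  ((1 / (2 * Real.pi) : ℂ) •
    ∫ η, Complex.exp (Complex.I * pairing (intPart z) η) • g η ∂floquetMeasure : L2 ϖ) (tr z)

end FloquetBergman

end

open FloquetBergman

/-!
After its singularities are removed, `Ψ = ϕ/φ` is holomorphic on `Ω`, decays summably over the cells
and satisfies `∑ₘ Ψ(z + m) = 1`. For `f ∈ A²(Ω)` the products of `f` with finite sums of translates
of `Ψ` converge to `f`, so the functions whose norms on the cells are summable are dense in `A²(Ω)`.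
The Floquet series of such a function is a continuous section of `η ↦ A²_η(ϖ)`, and since
`G = ∑ₘ e^{-iη·m} (G Ψ)(· + m)` for `η`-quasiperiodic `G`, the values of these sections at each `η`
exhaust `A²_{η,ext}(ϖ)`. Testing against the sections cut off to measurable sets of parameters shows
that an element orthogonal to `L²(𝐐; A²_η(ϖ))` is orthogonal to `A²_η(ϖ)` for almost every `η`, so
the orthogonal projection acts fibrewise. In the same way the Floquet transform, an isometry, maps
`A²(Ω)` into `L²(𝐐; A²_η(ϖ))` and `A²(Ω)ᗮ` into the orthogonal complement, hence intertwines the two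
projections. Applied to the Riesz representatives of the point evaluations, this yields the kernel
formulas.
-/

noncomputable section

namespace FloquetBergman

/-! ## Point evaluations on Bergman spaces -/

theorem eLpNorm_two_sq {α E : Type*} [MeasurableSpace α] [NormedAddCommGroup E] (f : α → E)
    (μ : Measure α) : eLpNorm f 2 μ ^ 2 = ∫⁻ x, ‖f x‖ₑ ^ 2 ∂μ := by
  simpa using eLpNorm_nnreal_pow_eq_lintegral (f := f) (μ := μ) (p := 2) two_ne_zero

theorem enorm_le_eLpNorm_ball {g : ℂ → ℂ} {c : ℂ} {R : ℝ} (hR : 0 < R)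
    (hg : DifferentiableOn ℂ g (Metric.ball c R)) :
    ENNReal.ofReal (R / 2) * ‖g c‖ₑ ≤ eLpNorm g 2 (volume.restrict (Metric.ball c R)) := by
  rw [← ENNReal.pow_le_pow_left_iff two_ne_zero, eLpNorm_two_sq, mul_pow]
  refine le_trans ?_ (area_sub_mean hR hg)
  rw [← ENNReal.ofReal_pow (by positivity)]
  gcongr
  nlinarith [sq_nonneg R]

section BergmanSpace

variable {D : Set ℂ} (hD : IsOpen D) {f : L2 D} {g : ℂ → ℂ} {z : ℂ}

theorem mem_bergmanSpace (hg : DifferentiableOn ℂ g D) (hfg : f =ᵐ[volume.restrict D] g) :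
    f ∈ bergmanSpace D := ⟨g, hg, hfg⟩

include hD

theorem completeSpace_bergmanSpace : CompleteSpace (bergmanSpace D) :=
  (isClosed_bergman hD).isComplete.completeSpace_coe

theorem holoRep_spec (hf : f ∈ bergmanSpace D) :
    DifferentiableOn ℂ (holoRep D f) D ∧ f =ᵐ[volume.restrict D] holoRep D f := by
  have h : ∃ g : ℂ → ℂ, DifferentiableOn ℂ g D ∧ f =ᵐ[volume.restrict D] g := hf
  simp only [holoRep, dif_pos h]
  obtain ⟨hdiff, hae⟩ := h.choose_spec
  refine ⟨hdiff.congr fun x hx => indicator_of_mem hx _, ?_⟩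
  filter_upwards [hae, ae_restrict_mem hD.measurableSet] with w hw hwD
  rw [hw, indicator_of_mem hwD]

theorem holoRep_eq (hg : DifferentiableOn ℂ g D) (hfg : f =ᵐ[volume.restrict D] g)
    (hz : z ∈ D) : holoRep D f z = g z := by
  obtain ⟨hdiff, hae⟩ := holoRep_spec hD (mem_bergmanSpace hg hfg)
  exact Measure.eqOn_open_of_ae_eq (hae.symm.trans hfg) hD hdiff.continuousOn hg.continuousOn hz

theorem exists_norm_holoRep_le (hz : z ∈ D) :
    ∃ C : ℝ, ∀ f ∈ bergmanSpace D, ‖holoRep D f z‖ ≤ C * ‖f‖ := by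
  obtain ⟨R, hR, hball⟩ := Metric.isOpen_iff.1 hD z hz
  refine ⟨2 / R, fun f hf => ?_⟩
  obtain ⟨hdiff, hae⟩ := holoRep_spec hD hf
  have hmean : ENNReal.ofReal (R / 2) * ‖holoRep D f z‖ₑ ≤ ‖f‖ₑ := by
    rw [Lp.enorm_def, eLpNorm_congr_ae hae]
    exact (enorm_le_eLpNorm_ball hR (hdiff.mono hball)).trans
      (eLpNorm_mono_measure _ (Measure.restrict_mono hball le_rfl))
  have hreal := ENNReal.toReal_mono enorm_ne_top hmean
  rw [ENNReal.toReal_mul, ENNReal.toReal_ofReal (by positivity), toReal_enorm, toReal_enorm]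
    at hreal
  calc ‖holoRep D f z‖ = 2 / R * (R / 2 * ‖holoRep D f z‖) := by field_simp
    _ ≤ 2 / R * ‖f‖ := by gcongr

variable (K : Submodule ℂ (L2 D)) [CompleteSpace K] (hK : K ≤ bergmanSpace D) (hz : z ∈ D)

include hK hz

theorem exists_evalVec : ∃ k ∈ K, ∀ f ∈ K, inner ℂ k f = holoRep D f z := by
  obtain ⟨C, hC⟩ := exists_norm_holoRep_le hD hz
  let evaluation : K →ₗ[ℂ] ℂ :=
    { toFun := fun f => holoRep D f z
      map_add' := by
        intro f g
        obtain ⟨hf, hfae⟩ := holoRep_spec hD (hK f.2)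
        obtain ⟨hg, hgae⟩ := holoRep_spec hD (hK g.2)
        exact holoRep_eq hD (hf.add hg) ((Lp.coeFn_add f.1 g.1).trans (hfae.add hgae)) hz
      map_smul' := by
        intro c f
        obtain ⟨hf, hfae⟩ := holoRep_spec hD (hK f.2)
        exact holoRep_eq hD (hf.const_smul c)
          ((Lp.coeFn_smul c f.1).trans (hfae.const_smul c)) hz }
  let L : K →L[ℂ] ℂ := evaluation.mkContinuous C fun f => hC f (hK f.2)
  exact ⟨(InnerProductSpace.toDual ℂ K).symm L, Submodule.coe_mem _, fun f hf =>
    InnerProductSpace.toDual_symm_apply (𝕜 := ℂ) (x := (⟨f, hf⟩ : K)) (y := L)⟩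

theorem evalVec_spec : evalVec K z ∈ K ∧ ∀ f ∈ K, inner ℂ (evalVec K z) f = holoRep D f z := by
  have h := exists_evalVec hD K hK hz
  simp only [evalVec, dif_pos h]
  exact h.choose_spec

theorem evalVec_eq {k : L2 D} (hk : k ∈ K) (h : ∀ f ∈ K, inner ℂ k f = holoRep D f z) :
    evalVec K z = k := by
  obtain ⟨hmem, heval⟩ := evalVec_spec hD K hK hz
  have hsub := sub_mem hmem hk
  rw [← sub_eq_zero, ← inner_self_eq_zero (𝕜 := ℂ), inner_sub_left, heval _ hsub, h _ hsub,
    sub_self]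

theorem inner_evalVec (f : L2 D) :
    inner ℂ (evalVec K z) f = holoRep D (K.starProjection f) z := by
  obtain ⟨hmem, heval⟩ := evalVec_spec hD K hK hz
  rw [← heval _ (Submodule.starProjection_apply_mem K f),
    ← Submodule.inner_starProjection_left_eq_right, Submodule.starProjection_eq_self_iff.2 hmem]

theorem ae_evalVec_eq :
    ∀ᵐ w ∂(volume.restrict D), evalVec K z w = starRingEnd ℂ (reproKernel K z w) := by
  filter_upwards [(holoRep_spec hD (hK (evalVec_spec hD K hK hz).1)).2] with w hw
  simp only [reproKernel, hw, Complex.conj_conj]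

theorem memLp_reproKernel : MemLp (reproKernel K z) 2 (volume.restrict D) := by
  refine (Lp.memLp (evalVec K z)).star.ae_eq ?_
  filter_upwards [ae_evalVec_eq hD K hK hz] with w hw
  simp [hw]

theorem integral_reproKernel (f : L2 D) :
    ∫ w in D, reproKernel K z w * f w = holoRep D (K.starProjection f) z := by
  rw [← inner_evalVec hD K hK hz, L2.inner_def]
  refine integral_congr_ae ?_
  filter_upwards [ae_evalVec_eq hD K hK hz] with w hw
  simp [hw, mul_comm]

end BergmanSpace

/-! ## The lattice and the cells -/

@[simp] theorem lat_re (m : ℤ × ℤ) : (lat m).re = m.1 := rfl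
@[simp] theorem lat_im (m : ℤ × ℤ) : (lat m).im = m.2 := rfl
@[simp] theorem lat_zero : lat 0 = 0 := by apply Complex.ext <;> simp
theorem lat_add (m n : ℤ × ℤ) : lat (m + n) = lat m + lat n := by apply Complex.ext <;> simp
theorem lat_neg (m : ℤ × ℤ) : lat (-m) = -lat m := by apply Complex.ext <;> simp
theorem lat_sub (m n : ℤ × ℤ) : lat (m - n) = lat m - lat n := by apply Complex.ext <;> simp
theorem lat_one_zero : lat (1, 0) = 1 := by apply Complex.ext <;> simp
theorem lat_zero_one : lat (0, 1) = Complex.I := by apply Complex.ext <;> simp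

theorem tr_add_lat_intPart (z : ℂ) : tr z + lat (intPart z) = z := sub_add_cancel _ _

theorem intPart_add_lat (z : ℂ) (m : ℤ × ℤ) : intPart (z + lat m) = intPart z + m := by
  simp [intPart, Prod.ext_iff]

theorem tr_add_lat (z : ℂ) (m : ℤ × ℤ) : tr (z + lat m) = tr z := by
  rw [tr, intPart_add_lat, lat_add, tr]; ring

theorem intPart_eq_zero {z : ℂ} (hz : z ∈ unitSquare) : intPart z = 0 :=
  Prod.ext (Int.floor_eq_zero_iff.2 ⟨hz.1.1.le, hz.1.2⟩)
    (Int.floor_eq_zero_iff.2 ⟨hz.2.1.le, hz.2.2⟩)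

theorem tr_eq_self {z : ℂ} (hz : z ∈ unitSquare) : tr z = z := by
  simp [tr, intPart_eq_zero hz]

theorem intPart_add_lat_of_mem {z : ℂ} (hz : z ∈ unitSquare) (m : ℤ × ℤ) :
    intPart (z + lat m) = m := by
  rw [intPart_add_lat, intPart_eq_zero hz, zero_add]

theorem tr_re_mem (z : ℂ) : (tr z).re ∈ Ico (0 : ℝ) 1 :=
  ⟨Int.fract_nonneg z.re, Int.fract_lt_one z.re⟩

theorem tr_im_mem (z : ℂ) : (tr z).im ∈ Ico (0 : ℝ) 1 :=
  ⟨Int.fract_nonneg z.im, Int.fract_lt_one z.im⟩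

theorem one_add_norm_intPart_le (z : ℂ) : 1 + ‖intPart z‖ ≤ 3 * (1 + ‖z‖) := by
  have floor_le : ∀ x : ℝ, |x| ≤ ‖z‖ → ‖(⌊x⌋ : ℤ)‖ ≤ 1 + ‖z‖ := by
    intro x hx
    rw [Int.norm_eq_abs, abs_le]
    have := abs_le.1 hx
    constructor <;> linarith [Int.floor_le x, Int.lt_floor_add_one x]
  have : ‖intPart z‖ ≤ 1 + ‖z‖ := norm_prod_le_iff.2
    ⟨floor_le _ (Complex.abs_re_le_norm z), floor_le _ (Complex.abs_im_le_norm z)⟩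
  linarith [norm_nonneg z]

theorem finite_intPart_image_ball (z : ℂ) (R : ℝ) : (intPart '' Metric.ball z R).Finite := by
  refine ((isCompact_closedBall (0 : ℤ × ℤ) (3 * (1 + (‖z‖ + R)))).finite_of_discrete).subset ?_
  rintro _ ⟨w, hw, rfl⟩
  rw [mem_closedBall_zero_iff]
  have hwz : ‖w‖ ≤ ‖z‖ + ‖w - z‖ := by simpa using norm_add_le z (w - z)
  linarith [one_add_norm_intPart_le w, mem_ball_iff_norm.1 hw]

theorem closure_unitSquare : closure unitSquare = Icc (0 : ℝ) 1 ×ℂ Icc (0 : ℝ) 1 := by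
  change closure (Ioo (0 : ℝ) 1 ×ℂ Ioo (0 : ℝ) 1) = _
  rw [Complex.closure_reProdIm, closure_Ioo zero_ne_one]

theorem tr_mem_closure_unitSquare (z : ℂ) : tr z ∈ closure unitSquare := by
  rw [closure_unitSquare]
  exact ⟨Ico_subset_Icc_self (tr_re_mem z), Ico_subset_Icc_self (tr_im_mem z)⟩

theorem eq_zero_of_sub_lat_mem_closure {z : ℂ} {m : ℤ × ℤ} (hz : z ∈ unitSquare)
    (h : z - lat m ∈ closure unitSquare) : m = 0 := by
  have eq_zero : ∀ {x : ℝ} {k : ℤ}, x ∈ Ioo (0 : ℝ) 1 → x - k ∈ Icc (0 : ℝ) 1 → k = 0 := by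
    rintro x k ⟨hx0, hx1⟩ ⟨hk0, hk1⟩
    have hk_lt : (k : ℝ) < 1 := by linarith
    have hk_gt : (-1 : ℝ) < k := by linarith
    norm_cast at hk_lt hk_gt
    omega
  rw [closure_unitSquare] at h
  exact Prod.ext (eq_zero hz.1 h.1) (eq_zero hz.2 h.2)

theorem mem_cellTranslate {A : Set ℂ} {m : ℤ × ℤ} {z : ℂ} :
    z ∈ cellTranslate A m ↔ z - lat m ∈ A := by
  constructor
  · rintro ⟨w, hw, rfl⟩; simpa using hw
  · intro h; exact ⟨_, h, by simp⟩

theorem closure_cellTranslate (A : Set ℂ) (m : ℤ × ℤ) :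
    closure (cellTranslate A m) = cellTranslate (closure A) m :=
  ((Homeomorph.addRight (lat m)).image_closure A).symm

theorem add_lat_mem_periodicDomain {ϖ : Set ℂ} {z : ℂ} (k : ℤ × ℤ) :
    z + lat k ∈ periodicDomain ϖ ↔ z ∈ periodicDomain ϖ := by
  have hinv : Homeomorph.addRight (lat k) ⁻¹' (⋃ m : ℤ × ℤ, closure (cellTranslate ϖ m)) =
      ⋃ m : ℤ × ℤ, closure (cellTranslate ϖ m) := by
    ext z
    simp only [mem_preimage, mem_iUnion, closure_cellTranslate, mem_cellTranslate,
      Homeomorph.coe_addRight]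
    refine (Equiv.subRight k).exists_congr fun m => ?_
    rw [Equiv.subRight_apply, lat_sub, sub_sub_eq_add_sub]
  have h := (Homeomorph.addRight (lat k)).preimage_interior
    (⋃ m : ℤ × ℤ, closure (cellTranslate ϖ m))
  rw [hinv] at h
  exact Set.ext_iff.1 h z

theorem sub_lat_mem_periodicDomain {ϖ : Set ℂ} {z : ℂ} (k : ℤ × ℤ) :
    z - lat k ∈ periodicDomain ϖ ↔ z ∈ periodicDomain ϖ := by
  rw [sub_eq_add_neg, ← lat_neg, add_lat_mem_periodicDomain]

theorem tr_mem_periodicDomain {ϖ : Set ℂ} {z : ℂ} :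
    tr z ∈ periodicDomain ϖ ↔ z ∈ periodicDomain ϖ :=
  sub_lat_mem_periodicDomain _

/-- The part of the definition of a periodic cell that makes the lattice translates of `ϖ` disjoint
open subsets of the periodic domain. -/
structure IsCell (ϖ : Set ℂ) : Prop where
  isOpen : IsOpen ϖ
  subset_unitSquare : ϖ ⊆ unitSquare

/-- A cell whose translates fill the periodic domain up to a null set. -/
structure IsTilingCell (ϖ : Set ℂ) : Prop extends IsCell ϖ where
  volume_diff_eq_zero : volume (periodicDomain ϖ \ ⋃ m, cellTranslate ϖ m) = 0

variable {ϖ : Set ℂ}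

theorem IsPeriodicCell.isTilingCell (hϖ : IsPeriodicCell ϖ)
    (hnull : volume (periodicDomain ϖ \ ⋃ m, cellTranslate ϖ m) = 0) : IsTilingCell ϖ :=
  ⟨⟨hϖ.isOpen, hϖ.subset_unitSquare⟩, hnull⟩

namespace IsCell

variable (hϖ : IsCell ϖ)

include hϖ

theorem isOpen_cellTranslate (m : ℤ × ℤ) : IsOpen (cellTranslate ϖ m) :=
  (Homeomorph.addRight (lat m)).isOpenMap _ hϖ.isOpen

theorem cellTranslate_subset (m : ℤ × ℤ) : cellTranslate ϖ m ⊆ periodicDomain ϖ :=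
  interior_maximal
    (subset_closure.trans (subset_iUnion (fun m => closure (cellTranslate ϖ m)) m))
    (hϖ.isOpen_cellTranslate m)

theorem add_lat_mem {z : ℂ} (hz : z ∈ ϖ) (m : ℤ × ℤ) : z + lat m ∈ periodicDomain ϖ :=
  hϖ.cellTranslate_subset m ⟨z, hz, rfl⟩

theorem subset_periodicDomain : ϖ ⊆ periodicDomain ϖ := fun z hz => by
  simpa using hϖ.add_lat_mem hz 0

theorem intPart_add_lat {z : ℂ} (hz : z ∈ ϖ) (m : ℤ × ℤ) : intPart (z + lat m) = m :=
  intPart_add_lat_of_mem (hϖ.subset_unitSquare hz) m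

theorem tr_add_lat {z : ℂ} (hz : z ∈ ϖ) (m : ℤ × ℤ) : tr (z + lat m) = z := by
  rw [FloquetBergman.tr_add_lat, tr_eq_self (hϖ.subset_unitSquare hz)]

theorem mem_closure_of_mem_unitSquare {z : ℂ} (hz : z ∈ periodicDomain ϖ)
    (hQ : z ∈ unitSquare) : z ∈ closure ϖ := by
  obtain ⟨m, hm⟩ := mem_iUnion.1 (interior_subset hz)
  rw [closure_cellTranslate, mem_cellTranslate] at hm
  have hm0 := eq_zero_of_sub_lat_mem_closure hQ (closure_mono hϖ.subset_unitSquare hm)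
  simpa [hm0] using hm

theorem mem_closure_of_mem {z : ℂ} (hz : z ∈ periodicDomain ϖ)
    (hQ : z ∈ closure unitSquare) : z ∈ closure ϖ := by
  refine closure_minimal ?_ isClosed_closure
    ((isOpen_periodicDomain ϖ).inter_closure ⟨hz, hQ⟩)
  exact fun w hw => hϖ.mem_closure_of_mem_unitSquare hw.1 hw.2

theorem pairwise_disjoint : Pairwise (Function.onFun Disjoint (cellTranslate ϖ)) := by
  refine fun m n hmn => Set.disjoint_left.2 ?_
  rintro _ ⟨z, hz, rfl⟩ ⟨w, hw, hwz⟩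
  rw [← hϖ.intPart_add_lat hz m, ← hϖ.intPart_add_lat hw n] at hmn
  exact hmn (congrArg intPart hwz).symm

end IsCell

theorem restrict_cellTranslate (m : ℤ × ℤ) :
    volume.restrict (cellTranslate ϖ m) = (volume.restrict ϖ).map (· + lat m) := by
  have h := ((measurePreserving_add_right (volume : Measure ℂ) (lat m)).restrict_image_emb
    (Homeomorph.addRight (lat m)).measurableEmbedding ϖ).map_eq
  exact h.symm

namespace IsTilingCell

variable (hϖ : IsTilingCell ϖ)

include hϖ

theorem restrict_periodicDomain : volume.restrict (periodicDomain ϖ) =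
    Measure.sum fun m => (volume.restrict ϖ).map (· + lat m) := by
  have hunion : volume.restrict (periodicDomain ϖ) =
      volume.restrict (⋃ m, cellTranslate ϖ m) := by
    refine (Measure.restrict_congr_set (ae_eq_set.2 ⟨?_, hϖ.volume_diff_eq_zero⟩)).symm
    rw [sdiff_eq_empty.2 (iUnion_subset hϖ.cellTranslate_subset), measure_empty]
  rw [hunion, Measure.restrict_iUnion hϖ.pairwise_disjoint
    fun m => (hϖ.isOpen_cellTranslate m).measurableSet]
  simp only [restrict_cellTranslate]

theorem lintegral_periodicDomain (f : ℂ → ℝ≥0∞) :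
    ∫⁻ z in periodicDomain ϖ, f z = ∑' m : ℤ × ℤ, ∫⁻ z in ϖ, f (z + lat m) := by
  rw [hϖ.restrict_periodicDomain, lintegral_sum_measure]
  exact tsum_congr fun m => (Homeomorph.addRight (lat m)).measurableEmbedding.lintegral_map _

theorem ae_periodicDomain_iff {p : ℂ → Prop} :
    (∀ᵐ z ∂(volume.restrict (periodicDomain ϖ)), p z) ↔
      ∀ m, ∀ᵐ z ∂(volume.restrict ϖ), p (z + lat m) := by
  rw [hϖ.restrict_periodicDomain, Measure.ae_sum_iff]
  exact forall_congr' fun m => (Homeomorph.addRight (lat m)).measurableEmbedding.ae_map_iff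

theorem ae_tr_mem : ∀ᵐ z ∂(volume.restrict (periodicDomain ϖ)), tr z ∈ ϖ := by
  refine hϖ.ae_periodicDomain_iff.2 fun m => ?_
  filter_upwards [ae_restrict_mem hϖ.isOpen.measurableSet] with z hz
  rwa [hϖ.tr_add_lat hz]

theorem eLpNorm_periodicDomain_le (F : ℂ → ℂ) :
    eLpNorm F 2 (volume.restrict (periodicDomain ϖ)) ≤
      ∑' m : ℤ × ℤ, eLpNorm (fun z => F (z + lat m)) 2 (volume.restrict ϖ) := by
  rw [← ENNReal.pow_le_pow_left_iff two_ne_zero, eLpNorm_two_sq, hϖ.lintegral_periodicDomain,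
    sq (tsum _), ← ENNReal.tsum_mul_right]
  refine ENNReal.tsum_le_tsum fun m => ?_
  rw [← eLpNorm_two_sq (fun z => F (z + lat m)), sq]
  gcongr
  exact ENNReal.le_tsum m

end IsTilingCell

/-! ## Partitions of unity by the lattice translates of a decaying function -/

theorem summable_one_add_norm_rpow {b : ℝ} (hb : 2 < b) :
    Summable fun n : ℤ × ℤ => (1 + ‖n‖) ^ (-b) := by
  have hsum := (finTwoArrowEquiv ℤ).symm.summable_iff.2
    (EisensteinSeries.summable_one_div_norm_rpow hb)
  refine hsum.of_norm_bounded_eventually ?_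
  have hne : ∀ᶠ n : ℤ × ℤ in cofinite, n ≠ 0 := by simp
  filter_upwards [hne] with n hn
  have hnorm : ‖(finTwoArrowEquiv ℤ).symm n‖ = ‖n‖ := by
    apply le_antisymm
    · refine (pi_norm_le_iff_of_nonneg (norm_nonneg _)).2 fun i => ?_
      fin_cases i
      · exact norm_fst_le n
      · exact norm_snd_le n
    · exact norm_prod_le_iff.2 ⟨norm_le_pi_norm ((finTwoArrowEquiv ℤ).symm n) 0,
        norm_le_pi_norm ((finTwoArrowEquiv ℤ).symm n) 1⟩
  rw [Function.comp_apply, hnorm, Real.norm_of_nonneg (by positivity)]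
  exact Real.rpow_le_rpow_of_nonpos (norm_pos_iff.2 hn) (by linarith) (by linarith)

theorem norm_le_of_rpow_mul_norm_le {E : Type*} [NormedAddCommGroup E] {x : E} {z : ℂ} {b d : ℝ}
    (hb : 0 ≤ b) (h : (1 + ‖z‖) ^ b * ‖x‖ ≤ d) :
    ‖x‖ ≤ |d| * 3 ^ b * (1 + ‖intPart z‖) ^ (-b) := by
  have hpos : 0 < 1 + ‖intPart z‖ := by positivity
  have hscale : (1 + ‖intPart z‖) ^ b ≤ 3 ^ b * (1 + ‖z‖) ^ b := by
    rw [← Real.mul_rpow (by norm_num) (by positivity)]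
    exact Real.rpow_le_rpow hpos.le (one_add_norm_intPart_le z) hb
  rw [Real.rpow_neg hpos.le, ← div_eq_mul_inv, le_div_iff₀ (by positivity)]
  calc ‖x‖ * (1 + ‖intPart z‖) ^ b ≤ ‖x‖ * (3 ^ b * (1 + ‖z‖) ^ b) := by gcongr
    _ = (1 + ‖z‖) ^ b * ‖x‖ * 3 ^ b := by ring
    _ ≤ |d| * 3 ^ b := by gcongr; exact h.trans (le_abs_self d)

theorem norm_le_of_hasSum_of_forall_ne {ι E : Type*} [NormedAddCommGroup E] {f : ι → E} {s : E}
    (hf : HasSum f s) {a : ι → ℝ} (ha : Summable a) (ha0 : ∀ j, 0 ≤ a j) {i : ι}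
    (hfa : ∀ j ≠ i, ‖f j‖ ≤ a j) : ‖f i‖ ≤ ‖s‖ + ∑' j, a j := by
  classical
  have hrest : ‖s - f i‖ ≤ ∑' j, a j := by
    refine (hf.sub (hasSum_ite_eq i (f i))).norm_le_of_bounded ha.hasSum fun j => ?_
    split_ifs with hj
    · simpa [hj] using ha0 i
    · simpa using hfa j hj
  calc ‖f i‖ = ‖s - (s - f i)‖ := by rw [sub_sub_cancel]
    _ ≤ ‖s‖ + ∑' j, a j := (norm_sub_le _ _).trans (by gcongr)

theorem analyticAt_of_ae_bounded {Ψ : ℂ → ℂ} {U : Set ℂ} (hU : IsOpen U) {B : ℝ}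
    (hB : ∀ᵐ z ∂(volume.restrict U), ‖Ψ z‖ ≤ B) {p : ℂ} (hp : p ∈ U) (hΨ : MeromorphicNFAt Ψ p) :
    AnalyticAt ℂ Ψ p := by
  rw [← hΨ.meromorphicOrderAt_nonneg_iff_analyticAt]
  by_contra! hneg
  have hlarge : ∀ᶠ z in 𝓝[≠] p, B < ‖Ψ z‖ :=
    (tendsto_norm_cobounded_atTop.comp ((tendsto_cobounded_iff_meromorphicOrderAt_neg
      hΨ.meromorphicAt).2 hneg)).eventually_gt_atTop B
  obtain ⟨u, hu, hpu, hsub⟩ := mem_nhdsWithin.1 hlarge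
  have hopen : IsOpen (u ∩ U ∩ {p}ᶜ) := (hu.inter hU).inter isOpen_compl_singleton
  have hne : (u ∩ U ∩ {p}ᶜ).Nonempty := nonempty_of_mem (f := 𝓝[≠] p)
    (inter_mem (mem_nhdsWithin_of_mem_nhds ((hu.inter hU).mem_nhds ⟨hpu, hp⟩)) self_mem_nhdsWithin)
  refine (hopen.measure_pos volume hne).ne' ?_
  rw [ae_restrict_iff' hU.measurableSet, ae_iff] at hB
  refine measure_mono_null ?_ hB
  rintro z ⟨⟨hzu, hzU⟩, hzp⟩ hz
  exact (hsub ⟨hzu, hzp⟩ : B < ‖Ψ z‖).not_ge (hz hzU)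

theorem exists_differentiableOn_ae_eq {R : ℂ → ℂ} {U : Set ℂ} (hU : IsOpen U)
    (hR : MeromorphicOn R U) {B : ℝ} (hB : ∀ᵐ z ∂(volume.restrict U), ‖R z‖ ≤ B) :
    ∃ Ψ : ℂ → ℂ, DifferentiableOn ℂ Ψ U ∧ Ψ =ᵐ[volume.restrict U] R := by
  have hae : toMeromorphicNFOn R U =ᵐ[volume.restrict U] R :=
    ae_restrict_le_codiscreteWithin hU.measurableSet (toMeromorphicNFOn_eqOn_codiscrete hR).symm
  refine ⟨toMeromorphicNFOn R U, fun p hp => ?_, hae⟩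
  refine (analyticAt_of_ae_bounded hU (B := B) ?_ hp
    (meromorphicNFOn_toMeromorphicNFOn R U hp)).differentiableAt.differentiableWithinAt
  filter_upwards [hB, hae] with z hz hzΨ
  rwa [hzΨ]

/-- A partition of unity on the periodic domain by the lattice translates of a holomorphic function
`Ψ`, where `a m` bounds `Ψ` on the cell `ϖ + m`. Both conditions are imposed cell by cell, so `z`
ranges over `ϖ`. -/
structure IsDecayingPartition (ϖ : Set ℂ) (Ψ : ℂ → ℂ) (a : ℤ × ℤ → ℝ) : Prop where
  differentiableOn : DifferentiableOn ℂ Ψ (periodicDomain ϖ)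
  summable : Summable a
  nonneg : ∀ m, 0 ≤ a m
  norm_le : ∀ m, ∀ᵐ z ∂(volume.restrict ϖ), ‖Ψ (z + lat m)‖ ≤ a m
  hasSum : ∀ᵐ z ∂(volume.restrict ϖ), HasSum (fun m => Ψ (z + lat m)) 1

theorem exists_isDecayingPartition (hϖ : IsTilingCell ϖ) {R : ℂ → ℂ} {a : ℤ × ℤ → ℝ}
    (hR : MeromorphicOn R (periodicDomain ϖ)) (ha : Summable a) (ha0 : ∀ m, 0 ≤ a m)
    (hRa : ∀ m ≠ 0, ∀ᵐ z ∂(volume.restrict ϖ), ‖R (z + lat m)‖ ≤ a m)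
    (hsum : ∀ᵐ z ∂(volume.restrict ϖ), HasSum (fun m => R (z + lat m)) 1) :
    ∃ Ψ a', IsDecayingPartition ϖ Ψ a' := by
  let a' := Function.update a 0 (1 + ∑' m, a m)
  have ha' : Summable a' := ha.update 0 _
  have ha'0 : ∀ m, 0 ≤ a' m := fun m => by
    by_cases hm : m = 0
    · subst hm
      simpa [a'] using add_nonneg zero_le_one (tsum_nonneg ha0)
    · simpa [a', hm] using ha0 m
  have hRa' : ∀ m, ∀ᵐ z ∂(volume.restrict ϖ), ‖R (z + lat m)‖ ≤ a' m := fun m => by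
    by_cases hm : m = 0
    · subst hm
      have hall : ∀ᵐ z ∂(volume.restrict ϖ), ∀ m ≠ 0, ‖R (z + lat m)‖ ≤ a m :=
        ae_all_iff.2 fun m => eventually_imp_distrib_left.2 (hRa m)
      filter_upwards [hsum, hall] with z hz hza
      simpa [a'] using norm_le_of_hasSum_of_forall_ne hz ha ha0 hza
    · simpa [a', hm] using hRa m hm
  obtain ⟨Ψ, hΨ, hΨR⟩ := exists_differentiableOn_ae_eq (isOpen_periodicDomain ϖ) hR
    (B := ∑' m, a' m) (hϖ.ae_periodicDomain_iff.2 fun m => (hRa' m).mono fun z hz =>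
      hz.trans (ha'.le_tsum m fun j _ => ha'0 j))
  have hcell := hϖ.ae_periodicDomain_iff.1 hΨR
  refine ⟨Ψ, a', hΨ, ha', ha'0, fun m => ?_, ?_⟩
  · filter_upwards [hRa' m, hcell m] with z hz hzΨ
    rwa [hzΨ]
  · filter_upwards [hsum, ae_all_iff.2 hcell] with z hz hzΨ
    simpa only [hzΨ] using hz

section ConditionA

variable {Φ : ℂ → ℂ} (hΦ : MeromorphicNFOn Φ univ)

theorem apply_add_lat (h1 : Function.Periodic Φ 1) (hI : Function.Periodic Φ Complex.I) (z : ℂ)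
    (m : ℤ × ℤ) : Φ (z + lat m) = Φ z := by
  have hlat : lat m = m.1 * 1 + m.2 * Complex.I := by apply Complex.ext <;> simp
  rw [hlat]
  exact (h1.int_mul m.1).add_period (h2 := hI.int_mul m.2) z

include hΦ

theorem analyticAt_inv_of_meromorphicOrderAt_nonpos {z : ℂ} (hz : meromorphicOrderAt Φ z ≤ 0) :
    AnalyticAt ℂ Φ⁻¹ z := by
  refine (hΦ (mem_univ z)).inv.meromorphicOrderAt_nonneg_iff_analyticAt.1 ?_
  rw [meromorphicOrderAt_inv]
  cases h : meromorphicOrderAt Φ z with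
  | top => simp
  | coe n =>
    rw [h] at hz
    have hn : n ≤ 0 := by exact_mod_cast hz
    exact_mod_cast neg_nonneg.2 hn

theorem exists_norm_inv_le (hper : ∀ z m, Φ (z + lat m) = Φ z)
    (h0 : ∀ z ∈ closure (periodicDomain ϖ), meromorphicOrderAt Φ z ≤ 0) :
    ∃ M : ℝ, 0 ≤ M ∧ ∀ z ∈ periodicDomain ϖ, ‖(Φ z)⁻¹‖ ≤ M := by
  have hK : IsCompact (closure (periodicDomain ϖ) ∩ closure unitSquare) := by
    rw [closure_unitSquare]
    exact (isCompact_Icc.reProdIm isCompact_Icc).inter_left isClosed_closure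
  obtain ⟨M, hM⟩ := hK.exists_bound_of_continuousOn (f := Φ⁻¹) fun z hz =>
    (analyticAt_inv_of_meromorphicOrderAt_nonpos hΦ (h0 z hz.1)).continuousAt.continuousWithinAt
  refine ⟨max M 0, le_max_right _ _, fun z hz => ?_⟩
  rw [← tr_add_lat_intPart z, hper]
  exact (hM (tr z) ⟨subset_closure (tr_mem_periodicDomain.2 hz),
    tr_mem_closure_unitSquare z⟩).trans (le_max_left _ _)

theorem ae_ne_zero_of_meromorphicOrderAt_nonpos {U : Set ℂ} (hU : IsOpen U)
    (h0 : ∀ z ∈ U, meromorphicOrderAt Φ z ≤ 0) : ∀ᵐ z ∂(volume.restrict U), Φ z ≠ 0 := by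
  have hanalytic := ae_restrict_le_codiscreteWithin (μ := volume) hU.measurableSet
    (MeromorphicOn.eventually_codiscreteWithin_analyticAt Φ
      (hΦ.meromorphicOn.mono_set (subset_univ U)))
  filter_upwards [hanalytic, ae_restrict_mem hU.measurableSet] with z hz hzU
  exact (hΦ (mem_univ z)).meromorphicOrderAt_eq_zero_iff.1
    (le_antisymm (h0 z hzU) hz.meromorphicOrderAt_nonneg)

end ConditionA

theorem ae_forall_sub_lat_notMem {S : Set ℂ} (hS : S.Countable) :
    ∀ᵐ z : ℂ, ∀ m, z - lat m ∉ S :=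
  ae_all_iff.2 fun m => (measurePreserving_sub_right volume (lat m)).quasiMeasurePreserving.ae
    (measure_eq_zero_iff_ae_notMem.1 (hS.measure_zero volume))

theorem ConditionA.exists_isDecayingPartition (hϖ : IsTilingCell ϖ) (hA : ConditionA ϖ) :
    ∃ Ψ a, IsDecayingPartition ϖ Ψ a := by
  obtain ⟨Φ, φ, hΦ, hp1, hpI, hΦ0, hφ, hfin, -, hsum, b, d, hb, hdec⟩ := hA
  have hper := apply_add_lat (Φ := Φ) hp1 hpI
  obtain ⟨M, hM0, hM⟩ := exists_norm_inv_le hΦ hper hΦ0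
  refine FloquetBergman.exists_isDecayingPartition hϖ (R := fun z => φ z * (Φ z)⁻¹)
    (a := fun m => |d| * 3 ^ b * (1 + ‖m‖) ^ (-b) * M)
    (fun z _ => (hφ (mem_univ z)).meromorphicAt.mul (hΦ (mem_univ z)).meromorphicAt.inv)
    (((summable_one_add_norm_rpow hb).mul_left _).mul_right M) (fun m => by positivity)
    (fun m hm => ?_) ?_
  · filter_upwards [ae_restrict_mem hϖ.isOpen.measurableSet] with z hz
    have hzQ := hϖ.subset_unitSquare hz
    have hnot : z + lat m ∉ closure unitSquare := fun h => hm <| neg_eq_zero.1 <|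
      eq_zero_of_sub_lat_mem_closure hzQ (by rwa [lat_neg, sub_neg_eq_add])
    have hzm := hϖ.add_lat_mem hz m
    have hφz := norm_le_of_rpow_mul_norm_le (by linarith) (hdec _ ⟨hzm, hnot⟩)
    rw [hϖ.intPart_add_lat hz] at hφz
    rw [norm_mul]
    exact mul_le_mul hφz (hM _ hzm) (norm_nonneg _) (by positivity)
  · have hne := ae_ne_zero_of_meromorphicOrderAt_nonpos hΦ (isOpen_periodicDomain ϖ)
      fun z hz => hΦ0 z (subset_closure hz)
    filter_upwards [ae_restrict_of_ae_restrict_of_subset hϖ.subset_periodicDomain hne,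
      ae_restrict_of_ae (ae_forall_sub_lat_notMem hfin.countable),
      ae_restrict_mem hϖ.isOpen.measurableSet] with z hz0 hpole hz
    have hone := (hsum z (hϖ.subset_periodicDomain hz) hpole).mul_right (Φ z)⁻¹
    rw [mul_inv_cancel₀ hz0, ← (Equiv.neg (ℤ × ℤ)).hasSum_iff] at hone
    refine hone.congr_fun fun m => ?_
    simp only [Function.comp_apply, Equiv.neg_apply, lat_neg, sub_neg_eq_add, hper]

/-! ## Quasiperiodic functions -/

theorem pairing_add (m n : ℤ × ℤ) (η : ℝ × ℝ) : pairing (m + n) η = pairing m η + pairing n η := by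
  simp [pairing]; ring

theorem pairing_neg (m : ℤ × ℤ) (η : ℝ × ℝ) : pairing (-m) η = -pairing m η := by
  simp [pairing]; ring

@[simp] theorem pairing_zero (η : ℝ × ℝ) : pairing 0 η = 0 := by simp [pairing]

theorem exp_pairing_add (m n : ℤ × ℤ) (η : ℝ × ℝ) :
    Complex.exp (Complex.I * pairing (m + n) η) =
      Complex.exp (Complex.I * pairing m η) * Complex.exp (Complex.I * pairing n η) := by
  rw [← Complex.exp_add, pairing_add]
  push_cast
  ring_nf

/-- Functions that pick up the factor `exp (i m · η)` under translation by `m ∈ ℤ + iℤ`. -/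
def IsQuasiperiodic (η : ℝ × ℝ) (G : ℂ → ℂ) : Prop :=
  ∀ z m, G (z + lat m) = Complex.exp (Complex.I * pairing m η) * G z

/-- The quasiperiodic function that coincides with `g` on the half-open unit square. -/
def quasiperiodicExtension (η : ℝ × ℝ) (g : ℂ → ℂ) (z : ℂ) : ℂ :=
  Complex.exp (Complex.I * pairing (intPart z) η) * g (tr z)

theorem isQuasiperiodic_quasiperiodicExtension (η : ℝ × ℝ) (g : ℂ → ℂ) :
    IsQuasiperiodic η (quasiperiodicExtension η g) := by
  intro z m
  simp only [quasiperiodicExtension, tr_add_lat, intPart_add_lat, add_comm (intPart z) m,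
    exp_pairing_add, mul_assoc]

theorem quasiperiodicExtension_of_mem {η : ℝ × ℝ} {g : ℂ → ℂ} {z : ℂ} (hz : z ∈ unitSquare) :
    quasiperiodicExtension η g z = g z := by
  simp [quasiperiodicExtension, intPart_eq_zero hz, tr_eq_self hz]

theorem frequently_nhdsNE_mem_Ioo {a b x : ℝ} (hab : a < b) (hx : x ∈ Icc a b) :
    ∃ᶠ t in 𝓝[≠] x, t ∈ Ioo a b := by
  rw [← mem_closure_ne_iff_frequently_within, sdiff_eq]
  refine closure_minimal ((dense_compl_singleton x).open_subset_closure_inter isOpen_Ioo)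
    isClosed_closure ?_
  rwa [closure_Ioo hab.ne]

theorem eventually_add_eq_mul {g : ℂ → ℂ} {V U : Set ℂ} (hV : IsOpen V)
    (hg : DifferentiableOn ℂ g V) (hU : IsOpen U) {u c e : ℂ} (hu : u ≠ 0)
    (h : ∀ t ∈ Ioo (0 : ℝ) 1, (t * u : ℂ) ∈ U → g (t * u + c) = e * g (t * u)) {t₀ : ℝ}
    (ht₀ : t₀ ∈ Icc (0 : ℝ) 1) {w : ℂ} (hw : w = t₀ * u) (hwU : w ∈ U) (hwV : w ∈ V)
    (hwc : w + c ∈ V) : ∀ᶠ z in 𝓝 w, g (z + c) = e * g z := by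
  subst hw
  have hshift : AnalyticAt ℂ (fun z => g (z + c)) (t₀ * u) :=
    (hg.analyticOnNhd hV _ hwc).comp_of_eq (f := fun z => z + c) (by fun_prop) rfl
  have hmul : AnalyticAt ℂ (fun z => e * g z) (t₀ * u) :=
    analyticAt_const.mul (hg.analyticOnNhd hV _ hwV)
  rw [← hshift.frequently_eq_iff_eventually_eq hmul]
  have hline : ContinuousAt (fun t : ℝ => (t * u : ℂ)) t₀ := by fun_prop
  have hpunctured : Tendsto (fun t : ℝ => (t * u : ℂ)) (𝓝[≠] t₀) (𝓝[≠] (t₀ * u : ℂ)) :=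
    hline.tendsto.inf (tendsto_principal_principal.2 fun t ht h => ht (by simpa [hu] using h))
  refine hpunctured.frequently (((frequently_nhdsNE_mem_Ioo one_pos ht₀).and_eventually
    (nhdsWithin_le_nhds (hline.eventually_mem (hU.mem_nhds hwU)))).mono ?_)
  exact fun t ht => h t ht.1 ht.2

theorem eventually_sub_lat_intPart_mem_closure (w : ℂ) :
    ∀ᶠ z in 𝓝 w, w - lat (intPart z) ∈ closure unitSquare := by
  have hfar : ∀ l ∈ intPart '' Metric.ball w 1, w - lat l ∉ closure unitSquare →
      ∀ᶠ z in 𝓝 w, z - lat l ∉ closure unitSquare := fun l _ hl =>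
    (by fun_prop : Continuous fun z => z - lat l).continuousAt.eventually_mem
      (isClosed_closure.isOpen_compl.mem_nhds hl)
  have hfar' : ∀ᶠ z in 𝓝 w, ∀ l ∈ intPart '' Metric.ball w 1,
      w - lat l ∉ closure unitSquare → z - lat l ∉ closure unitSquare := by
    refine (finite_intPart_image_ball w 1).eventually_all.2 fun l hl => ?_
    by_cases hwl : w - lat l ∈ closure unitSquare
    · simp [hwl]
    · filter_upwards [hfar l hl hwl] with z hz _ using hz
  filter_upwards [hfar', Metric.ball_mem_nhds w one_pos] with z hz hzw
  by_contra hcontra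
  exact hz _ (mem_image_of_mem _ hzw) hcontra (tr_mem_closure_unitSquare z)

section BoundaryConditions

variable {V : Set ℂ} {g : ℂ → ℂ} {η : ℝ × ℝ}
  (hV : IsOpen V) (hsub : closure unitSquare ∩ periodicDomain ϖ ⊆ V)
  (hg : DifferentiableOn ℂ g V)

include hV hsub hg

theorem eventually_add_one
    (hp : ∀ y ∈ Ioo (0 : ℝ) 1, (y * Complex.I : ℂ) ∈ periodicDomain ϖ →
      g (1 + y * Complex.I) = Complex.exp (Complex.I * η.1) * g (y * Complex.I))
    {w : ℂ} (hw : w ∈ periodicDomain ϖ) (hwQ : w ∈ closure unitSquare)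
    (hwQ' : w + lat (1, 0) ∈ closure unitSquare) :
    ∀ᶠ z in 𝓝 w, g (z + lat (1, 0)) = Complex.exp (Complex.I * pairing (1, 0) η) * g z := by
  have hwV' := hsub ⟨hwQ', (add_lat_mem_periodicDomain _).2 hw⟩
  have hwV := hsub ⟨hwQ, hw⟩
  rw [closure_unitSquare] at hwQ hwQ'
  have hre : w.re = 0 := le_antisymm (by simpa using hwQ'.1.2) hwQ.1.1
  have hw_eq : w = w.im * Complex.I := by apply Complex.ext <;> simp [hre]
  rw [lat_one_zero] at hwV' ⊢
  simpa [pairing] using eventually_add_eq_mul hV hg (isOpen_periodicDomain ϖ) Complex.I_ne_zero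
    (fun y hy hyΩ => by rw [add_comm, hp y hy hyΩ]) hwQ.2 hw_eq hw hwV hwV'

theorem eventually_add_I
    (hq : ∀ x ∈ Ioo (0 : ℝ) 1, (x : ℂ) ∈ periodicDomain ϖ →
      g (x + Complex.I) = Complex.exp (Complex.I * η.2) * g x)
    {w : ℂ} (hw : w ∈ periodicDomain ϖ) (hwQ : w ∈ closure unitSquare)
    (hwQ' : w + lat (0, 1) ∈ closure unitSquare) :
    ∀ᶠ z in 𝓝 w, g (z + lat (0, 1)) = Complex.exp (Complex.I * pairing (0, 1) η) * g z := by
  have hwV' := hsub ⟨hwQ', (add_lat_mem_periodicDomain _).2 hw⟩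
  have hwV := hsub ⟨hwQ, hw⟩
  rw [closure_unitSquare] at hwQ hwQ'
  have him : w.im = 0 := le_antisymm (by simpa using hwQ'.2.2) hwQ.2.1
  have hw_eq : w = w.re * 1 := by apply Complex.ext <;> simp [him]
  rw [lat_zero_one] at hwV' ⊢
  simpa [pairing] using eventually_add_eq_mul hV hg (isOpen_periodicDomain ϖ) one_ne_zero
    (by simpa using hq) hwQ.1 hw_eq hw hwV hwV'

theorem eventually_add_lat
    (hp : ∀ y ∈ Ioo (0 : ℝ) 1, (y * Complex.I : ℂ) ∈ periodicDomain ϖ →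
      g (1 + y * Complex.I) = Complex.exp (Complex.I * η.1) * g (y * Complex.I))
    (hq : ∀ x ∈ Ioo (0 : ℝ) 1, (x : ℂ) ∈ periodicDomain ϖ →
      g (x + Complex.I) = Complex.exp (Complex.I * η.2) * g x)
    {w : ℂ} (hw : w ∈ periodicDomain ϖ) (hre : w.re ∈ Ico (0 : ℝ) 1) (him : w.im ∈ Ico (0 : ℝ) 1)
    {k : ℤ × ℤ} (hk : w + lat k ∈ closure unitSquare) :
    ∀ᶠ z in 𝓝 w, g (z + lat k) = Complex.exp (Complex.I * pairing k η) * g z := by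
  have eq_zero_or_one : ∀ {x : ℝ} {j : ℤ}, x ∈ Ico (0 : ℝ) 1 → x + j ∈ Icc (0 : ℝ) 1 →
      j = 0 ∨ j = 1 := by
    rintro x j ⟨hx0, hx1⟩ ⟨hj0, hj1⟩
    have hj_gt : (-1 : ℝ) < j := by linarith
    have hj_lt : (j : ℝ) < 2 := by linarith
    norm_cast at hj_gt hj_lt
    lia
  have hwQ : w ∈ closure unitSquare := by
    rw [closure_unitSquare]; exact ⟨Ico_subset_Icc_self hre, Ico_subset_Icc_self him⟩
  obtain ⟨k₁, k₂⟩ := k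
  have hk' := hk
  rw [closure_unitSquare] at hk'
  obtain rfl | rfl := eq_zero_or_one hre (by simpa using hk'.1) <;>
    obtain rfl | rfl := eq_zero_or_one him (by simpa using hk'.2)
  · simp [← Prod.zero_eq_mk]
  · exact eventually_add_I hV hsub hg hq hw hwQ hk
  · exact eventually_add_one hV hsub hg hp hw hwQ hk
  · have hw1Q : w + lat (1, 0) ∈ closure unitSquare := by
      rw [closure_unitSquare]
      exact ⟨by simpa using hk'.1, by simpa using Ico_subset_Icc_self him⟩
    have hsplit : ((1, 1) : ℤ × ℤ) = (0, 1) + (1, 0) := rfl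
    have hlat : ∀ z, z + lat (1, 1) = z + lat (1, 0) + lat (0, 1) := fun z => by
      rw [hsplit, lat_add, add_assoc, add_comm (lat (0, 1))]
    have hI := ((continuous_add_const (lat (1, 0))).tendsto w).eventually
      (eventually_add_I hV hsub hg hq ((add_lat_mem_periodicDomain _).2 hw) hw1Q (hlat w ▸ hk))
    filter_upwards [hI, eventually_add_one hV hsub hg hp hw hwQ hw1Q] with z hzI hz1
    rw [hlat, hzI, hz1, hsplit, exp_pairing_add, mul_assoc]

theorem differentiableOn_quasiperiodicExtension
    (hp : ∀ y ∈ Ioo (0 : ℝ) 1, (y * Complex.I : ℂ) ∈ periodicDomain ϖ →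
      g (1 + y * Complex.I) = Complex.exp (Complex.I * η.1) * g (y * Complex.I))
    (hq : ∀ x ∈ Ioo (0 : ℝ) 1, (x : ℂ) ∈ periodicDomain ϖ →
      g (x + Complex.I) = Complex.exp (Complex.I * η.2) * g x) :
    DifferentiableOn ℂ (quasiperiodicExtension η g) (periodicDomain ϖ) := by
  intro z hz
  have htrΩ : tr z ∈ periodicDomain ϖ := tr_mem_periodicDomain.2 hz
  have hgtr : DifferentiableAt ℂ g (tr z) :=
    hg.differentiableAt (hV.mem_nhds (hsub ⟨tr_mem_closure_unitSquare z, htrΩ⟩))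
  have hshifts : ∀ᶠ v in 𝓝 (tr z), ∀ l ∈ intPart '' Metric.ball (tr z) 1,
      tr z + lat (-l) ∈ closure unitSquare →
      g (v + lat (-l)) = Complex.exp (Complex.I * pairing (-l) η) * g v := by
    refine (finite_intPart_image_ball _ 1).eventually_all.2 fun l _ => ?_
    by_cases hl : tr z + lat (-l) ∈ closure unitSquare
    · filter_upwards [eventually_add_lat hV hsub hg hp hq htrΩ (tr_re_mem z) (tr_im_mem z) hl]
        with v hv _ using hv
    · simp [hl]
  have hext : quasiperiodicExtension η g =ᶠ[𝓝 (tr z)] g := by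
    filter_upwards [hshifts, eventually_sub_lat_intPart_mem_closure (tr z),
      Metric.ball_mem_nhds _ one_pos] with v hv hclosure hball
    have htr : tr v = v + lat (-intPart v) := by rw [tr, lat_neg, sub_eq_add_neg]
    rw [sub_eq_add_neg, ← lat_neg] at hclosure
    rw [quasiperiodicExtension, htr, hv _ (mem_image_of_mem _ hball) hclosure, ← mul_assoc,
      ← exp_pairing_add, add_neg_cancel, pairing_zero]
    simp
  have hfactor : quasiperiodicExtension η g = fun v =>
      Complex.exp (Complex.I * pairing (intPart z) η) *
        quasiperiodicExtension η g (v - lat (intPart z)) := by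
    funext v
    rw [← isQuasiperiodic_quasiperiodicExtension, sub_add_cancel]
  rw [hfactor]
  have hcomp : DifferentiableAt ℂ (fun v => quasiperiodicExtension η g (v - lat (intPart z))) z :=
    DifferentiableAt.fun_comp' z (f := fun v => v - lat (intPart z))
      (hgtr.congr_of_eventuallyEq hext) (by fun_prop)
  exact (hcomp.const_mul _).differentiableWithinAt

end BoundaryConditions

theorem mem_quasiExt_iff (hϖ : IsCell ϖ) {η : ℝ × ℝ} {f : L2 ϖ} :
    f ∈ quasiExt ϖ η ↔ ∃ G : ℂ → ℂ, DifferentiableOn ℂ G (periodicDomain ϖ) ∧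
      f =ᵐ[volume.restrict ϖ] G ∧ IsQuasiperiodic η G := by
  constructor
  · rintro ⟨-, V, g, hV, hsub, -, hg, hfg, hp, hq⟩
    refine ⟨quasiperiodicExtension η g, differentiableOn_quasiperiodicExtension hV
      (fun z hz => hsub ⟨hϖ.mem_closure_of_mem hz.2 hz.1, hz.2⟩) hg hp hq, ?_,
      isQuasiperiodic_quasiperiodicExtension η g⟩
    filter_upwards [hfg, ae_restrict_mem hϖ.isOpen.measurableSet] with z hz hzϖ
    rw [hz, quasiperiodicExtension_of_mem (hϖ.subset_unitSquare hzϖ)]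
  · rintro ⟨G, hG, hfG, hper⟩
    refine ⟨mem_bergmanSpace (hG.mono hϖ.subset_periodicDomain) hfG, periodicDomain ϖ, G,
      isOpen_periodicDomain ϖ, inter_subset_right, subset_rfl, hG, hfG, fun y _ _ => ?_,
      fun x _ _ => ?_⟩
    · simpa [pairing, lat_one_zero, add_comm] using hper (y * Complex.I) (1, 0)
    · simpa [pairing, lat_zero_one] using hper x (0, 1)

theorem quasiSpace_le_bergmanSpace (hϖ : IsCell ϖ) (η : ℝ × ℝ) :
    quasiSpace ϖ η ≤ bergmanSpace ϖ :=
  Submodule.topologicalClosure_minimal _ (fun _ hf => hf.1) (isClosed_bergman hϖ.isOpen)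

/-! ## Restriction to the cells -/

theorem cellPart_ae_eq_indicator (m : ℤ × ℤ) {f : L2 (periodicDomain ϖ)} {g : ℂ → ℂ}
    (h : f =ᵐ[volume.restrict (periodicDomain ϖ)] g) :
    cellPart ϖ m f =ᵐ[volume.restrict ϖ] fun z => (periodicDomain ϖ).indicator g (z + lat m) := by
  have hind := (ae_eq_restrict_iff_indicator_ae_eq (isOpen_periodicDomain ϖ).measurableSet).1 h
  exact (memLp_cellPart ϖ m f).coeFn_toLp.trans (ae_restrict_of_ae
    ((measurePreserving_add_right volume (lat m)).quasiMeasurePreserving.ae_eq hind))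

theorem cellPart_add (m : ℤ × ℤ) (f g : L2 (periodicDomain ϖ)) :
    cellPart ϖ m (f + g) = cellPart ϖ m f + cellPart ϖ m g := by
  apply Lp.ext
  filter_upwards [cellPart_ae_eq_indicator m (Lp.coeFn_add f g),
    cellPart_ae_eq_indicator m (.refl _ f), cellPart_ae_eq_indicator m (.refl _ g),
    Lp.coeFn_add (cellPart ϖ m f) (cellPart ϖ m g)]
    with z hsum hf hg hadd
  rw [hsum, hadd, Pi.add_apply, hf, hg, indicator_add', Pi.add_apply]

theorem cellPart_smul (m : ℤ × ℤ) (c : ℂ) (f : L2 (periodicDomain ϖ)) :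
    cellPart ϖ m (c • f) = c • cellPart ϖ m f := by
  apply Lp.ext
  filter_upwards [cellPart_ae_eq_indicator m (Lp.coeFn_smul c f),
    cellPart_ae_eq_indicator m (.refl _ f), Lp.coeFn_smul c (cellPart ϖ m f)] with z hcf hf hsmul
  rw [hcf, hsmul, Pi.smul_apply, hf]
  exact indicator_const_smul_apply _ c f _

theorem IsCell.cellPart_ae_eq (hϖ : IsCell ϖ) (m : ℤ × ℤ) {f : L2 (periodicDomain ϖ)} {g : ℂ → ℂ}
    (h : f =ᵐ[volume.restrict (periodicDomain ϖ)] g) :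
    cellPart ϖ m f =ᵐ[volume.restrict ϖ] fun z => g (z + lat m) := by
  filter_upwards [cellPart_ae_eq_indicator m h, ae_restrict_mem hϖ.isOpen.measurableSet]
    with z hf hz
  rw [hf, indicator_of_mem (hϖ.add_lat_mem hz m)]

theorem IsCell.exists_cellPart_eq_single (hϖ : IsCell ϖ) (n : ℤ × ℤ) (h : L2 ϖ) :
    ∃ e : L2 (periodicDomain ϖ), cellPart ϖ n e = h ∧ ∀ m ≠ n, cellPart ϖ m e = 0 := by
  have hind : MemLp (ϖ.indicator h) 2 volume :=
    (memLp_indicator_iff_restrict hϖ.isOpen.measurableSet).2 (Lp.memLp h)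
  have hshift : MemLp (fun z => ϖ.indicator h (z - lat n)) 2
      (volume.restrict (periodicDomain ϖ)) :=
    (hind.comp_measurePreserving (measurePreserving_sub_right volume (lat n))).restrict _
  refine ⟨hshift.toLp, ?_, fun m hm => ?_⟩
  · apply Lp.ext
    filter_upwards [hϖ.cellPart_ae_eq n hshift.coeFn_toLp, ae_restrict_mem hϖ.isOpen.measurableSet]
      with z he hz
    rw [he, add_sub_cancel_right, indicator_of_mem hz]
  · apply Lp.ext
    filter_upwards [hϖ.cellPart_ae_eq m hshift.coeFn_toLp, ae_restrict_mem hϖ.isOpen.measurableSet,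
      Lp.coeFn_zero ℂ 2 (volume.restrict ϖ)] with z he hz hzero
    rw [he, hzero, indicator_of_notMem, Pi.zero_apply]
    exact fun hmem => Set.disjoint_left.1 (hϖ.pairwise_disjoint hm) ⟨z, hz, rfl⟩
      (mem_cellTranslate.2 hmem)

theorem IsTilingCell.hasSum_norm_sq_cellPart (hϖ : IsTilingCell ϖ) (f : L2 (periodicDomain ϖ)) :
    HasSum (fun m => ‖cellPart ϖ m f‖ ^ 2) (‖f‖ ^ 2) := by
  have htsum : ∑' m, ‖cellPart ϖ m f‖ₑ ^ 2 = ‖f‖ₑ ^ 2 := by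
    simp only [Lp.enorm_def, eLpNorm_two_sq]
    rw [hϖ.lintegral_periodicDomain]
    refine tsum_congr fun m => lintegral_congr_ae ?_
    filter_upwards [hϖ.cellPart_ae_eq m (.refl _ f)] with z hz
    rw [hz]
  have hsum := htsum ▸ (ENNReal.summable (f := fun m => ‖cellPart ϖ m f‖ₑ ^ 2)).hasSum
  simp only [enorm_eq_nnnorm, ← ENNReal.coe_pow] at hsum
  simpa using NNReal.hasSum_coe.2 (ENNReal.hasSum_coe.1 hsum)

theorem IsTilingCell.memℓp_cellPart (hϖ : IsTilingCell ϖ) (f : L2 (periodicDomain ϖ)) :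
    Memℓp (fun m => cellPart ϖ m f) 2 :=
  memℓp_gen (by simpa using (hϖ.hasSum_norm_sq_cellPart f).summable)

/-- The decomposition of `L²(Ω)` into the `L²` spaces of the cells, as an isometry into the Hilbert
sum of copies of `L²(ϖ)`. -/
def cellDecomposition (hϖ : IsTilingCell ϖ) :
    L2 (periodicDomain ϖ) →ₗᵢ[ℂ] lp (fun _ : ℤ × ℤ => L2 ϖ) 2 where
  toFun f := ⟨fun m => cellPart ϖ m f, hϖ.memℓp_cellPart f⟩
  map_add' f g := Subtype.ext (funext fun m => cellPart_add m f g)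
  map_smul' c f := Subtype.ext (funext fun m => cellPart_smul m c f)
  norm_map' f := by
    have hnorm := lp.norm_rpow_eq_tsum (p := 2) (by norm_num)
      (⟨fun m => cellPart ϖ m f, hϖ.memℓp_cellPart f⟩ : lp (fun _ : ℤ × ℤ => L2 ϖ) 2)
    simp only [ENNReal.toReal_ofNat, Real.rpow_ofNat, (hϖ.hasSum_norm_sq_cellPart f).tsum_eq]
      at hnorm
    exact (pow_left_inj₀ (norm_nonneg _) (norm_nonneg _) two_ne_zero).1 hnorm

theorem inner_eq_tsum_cellPart (hϖ : IsTilingCell ϖ) (f g : L2 (periodicDomain ϖ)) :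
    inner ℂ f g = ∑' m, inner ℂ (cellPart ϖ m f) (cellPart ϖ m g) := by
  rw [← (cellDecomposition hϖ).inner_map_map, lp.inner_eq_tsum]
  rfl

/-! ## The Floquet transform as an isometry -/

theorem integral_exp_int_mul (k : ℤ) :
    ∫ x in Icc (-Real.pi) Real.pi, Complex.exp (Complex.I * (k * x : ℝ)) =
      if k = 0 then (2 * Real.pi : ℂ) else 0 := by
  rw [integral_Icc_eq_integral_Ioc, ← intervalIntegral.integral_of_le (by linarith [Real.pi_pos])]
  split_ifs with hk
  · subst hk
    simp only [Int.cast_zero, zero_mul, Complex.ofReal_zero, mul_zero, Complex.exp_zero,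
      intervalIntegral.integral_const, Complex.real_smul]
    push_cast
    ring
  · have hassoc : ∀ x : ℝ, Complex.I * ((k * x : ℝ) : ℂ) = Complex.I * k * x := fun x => by
      push_cast; ring
    simp only [hassoc]
    rw [integral_exp_mul_complex (mul_ne_zero Complex.I_ne_zero (by exact_mod_cast hk)),
      div_eq_zero_iff, sub_eq_zero, Complex.exp_eq_exp_iff_exists_int]
    exact Or.inl ⟨k, by push_cast; ring⟩

theorem integral_exp_pairing (m : ℤ × ℤ) :
    ∫ η, Complex.exp (Complex.I * pairing m η) ∂floquetMeasure =
      if m = 0 then (4 * Real.pi ^ 2 : ℂ) else 0 := by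
  have hprod : ∀ η : ℝ × ℝ, Complex.exp (Complex.I * pairing m η) =
      Complex.exp (Complex.I * (m.1 * η.1 : ℝ)) * Complex.exp (Complex.I * (m.2 * η.2 : ℝ)) := by
    intro η
    rw [← Complex.exp_add, pairing]
    push_cast; ring_nf
  simp only [hprod, floquetMeasure, floquetSquare, Measure.volume_eq_prod, ← Measure.prod_restrict]
  rw [integral_prod_mul (fun x : ℝ => Complex.exp (Complex.I * (m.1 * x : ℝ)))
    (fun x : ℝ => Complex.exp (Complex.I * (m.2 * x : ℝ))), integral_exp_int_mul,
    integral_exp_int_mul]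
  by_cases h₁ : m.1 = 0 <;> by_cases h₂ : m.2 = 0 <;> simp [Prod.ext_iff, h₁, h₂]
  ring

theorem norm_exp_I_mul (x : ℝ) : ‖Complex.exp (Complex.I * x)‖ = 1 := by
  rw [mul_comm, Complex.norm_exp_ofReal_mul_I]

@[fun_prop]
theorem continuous_pairing (m : ℤ × ℤ) : Continuous (pairing m) := by
  unfold pairing; fun_prop

theorem integrable_exp_smul {E : Type*} [NormedAddCommGroup E] [NormedSpace ℂ E]
    {g : ℝ × ℝ → E} (hg : Integrable g floquetMeasure) (m : ℤ × ℤ) :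
    Integrable (fun η => Complex.exp (Complex.I * pairing m η) • g η) floquetMeasure :=
  hg.bdd_smul 1 (Continuous.aestronglyMeasurable (by fun_prop))
    (Eventually.of_forall fun η => (norm_exp_I_mul _).le)

theorem integrable_bochnerL2 (g : BochnerL2 ϖ) : Integrable g floquetMeasure :=
  (Lp.memLp g).integrable one_le_two

theorem inner_mode (m : ℤ × ℤ) (h : L2 ϖ) (g : BochnerL2 ϖ) :
    inner ℂ (memLp_mode ϖ m h).toLp g =
      ∫ η, Complex.exp (Complex.I * pairing m η) * inner ℂ h (g η) ∂floquetMeasure := by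
  rw [L2.inner_def]
  refine integral_congr_ae ?_
  filter_upwards [(memLp_mode ϖ m h).coeFn_toLp] with η hη
  rw [hη, inner_smul_left, ← Complex.exp_conj]
  simp

theorem inner_mode_mode (m n : ℤ × ℤ) (h h' : L2 ϖ) :
    inner ℂ (memLp_mode ϖ m h).toLp (memLp_mode ϖ n h').toLp =
      (if m = n then (4 * Real.pi ^ 2 : ℂ) else 0) * inner ℂ h h' := by
  have horth := integral_exp_pairing (m - n)
  simp only [sub_eq_zero] at horth
  rw [inner_mode, ← horth, ← integral_mul_const]
  refine integral_congr_ae ?_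
  filter_upwards [(memLp_mode ϖ n h').coeFn_toLp] with η hη
  rw [hη, inner_smul_right, ← mul_assoc, ← Complex.exp_add, sub_eq_add_neg, pairing_add,
    pairing_neg]
  push_cast
  ring_nf

/-- The isometric embedding `h ↦ (2π)⁻¹ exp (-i m · η) h` of `L²(ϖ)` into `L²(𝐐; L²(ϖ))`. -/
def floquetMode (ϖ : Set ℂ) (m : ℤ × ℤ) : L2 ϖ →ₗᵢ[ℂ] BochnerL2 ϖ :=
  LinearMap.isometryOfInner
    { toFun h := (1 / (2 * Real.pi) : ℂ) • (memLp_mode ϖ m h).toLp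
      map_add' h h' := by
        rw [← smul_add, ← MemLp.toLp_add]
        congr 1
        exact MemLp.toLp_congr _ _ (Eventually.of_forall fun η => smul_add _ h h')
      map_smul' c h := by
        rw [RingHom.id_apply, smul_comm, ← MemLp.toLp_const_smul c (memLp_mode ϖ m h)]
        congr 1
        exact MemLp.toLp_congr _ _ (Eventually.of_forall fun η => smul_comm _ c h) }
    fun h h' => by
      have hpi : (Real.pi : ℂ) ≠ 0 := by exact_mod_cast Real.pi_ne_zero
      simp only [LinearMap.coe_mk, AddHom.coe_mk, inner_smul_left, inner_smul_right,
        inner_mode_mode, if_true, map_div₀, map_one, map_mul, map_ofNat, Complex.conj_ofReal]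
      field_simp
      ring

theorem floquetMode_apply (m : ℤ × ℤ) (h : L2 ϖ) :
    floquetMode ϖ m h = (1 / (2 * Real.pi) : ℂ) • (memLp_mode ϖ m h).toLp := rfl

theorem orthogonalFamily_floquetMode (ϖ : Set ℂ) :
    OrthogonalFamily ℂ (fun _ : ℤ × ℤ => L2 ϖ) (floquetMode ϖ) := fun m n hmn h h' => by
  rw [floquetMode_apply, floquetMode_apply, inner_smul_left, inner_smul_right, inner_mode_mode,
    if_neg hmn, zero_mul, mul_zero, mul_zero]

/-- The Floquet transform as a linear isometry. -/
def floquetIsometry (hϖ : IsTilingCell ϖ) : L2 (periodicDomain ϖ) →ₗᵢ[ℂ] BochnerL2 ϖ :=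
  (orthogonalFamily_floquetMode ϖ).linearIsometry.comp (cellDecomposition hϖ)

theorem hasSum_floquetIsometry (hϖ : IsTilingCell ϖ) (f : L2 (periodicDomain ϖ)) :
    HasSum (fun m => floquetMode ϖ m (cellPart ϖ m f)) (floquetIsometry hϖ f) :=
  (orthogonalFamily_floquetMode ϖ).hasSum_linearIsometry (cellDecomposition hϖ f)

theorem floquetIsometry_apply (hϖ : IsTilingCell ϖ) (f : L2 (periodicDomain ϖ)) :
    floquetIsometry hϖ f = floquet ϖ f := by
  rw [← (hasSum_floquetIsometry hϖ f).tsum_eq, floquet]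
  simp only [floquetMode_apply]
  rw [tsum_const_smul'']

theorem floquetIsometry_eq_floquetMode (hϖ : IsTilingCell ϖ) {n : ℤ × ℤ}
    {f : L2 (periodicDomain ϖ)} (hf : ∀ m ≠ n, cellPart ϖ m f = 0) :
    floquetIsometry hϖ f = floquetMode ϖ n (cellPart ϖ n f) :=
  (hasSum_floquetIsometry hϖ f).unique
    (hasSum_single n fun m hm => by rw [hf m hm, map_zero])

/-- The adjoint of the Floquet transform; it is given by the formula that defines `F⁻¹`. -/
def floquetAdjoint (hϖ : IsTilingCell ϖ) : BochnerL2 ϖ →L[ℂ] L2 (periodicDomain ϖ) :=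
  ContinuousLinearMap.adjoint (floquetIsometry hϖ).toContinuousLinearMap

theorem inner_floquetAdjoint (hϖ : IsTilingCell ϖ) (f : L2 (periodicDomain ϖ)) (g : BochnerL2 ϖ) :
    inner ℂ f (floquetAdjoint hϖ g) = inner ℂ (floquetIsometry hϖ f) g :=
  ContinuousLinearMap.adjoint_inner_right _ _ _

theorem floquetAdjoint_floquetIsometry (hϖ : IsTilingCell ϖ) (f : L2 (periodicDomain ϖ)) :
    floquetAdjoint hϖ (floquetIsometry hϖ f) = f :=
  ext_inner_left ℂ fun h => by rw [inner_floquetAdjoint, LinearIsometry.inner_map_map]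

theorem cellPart_floquetAdjoint (hϖ : IsTilingCell ϖ) (n : ℤ × ℤ) (g : BochnerL2 ϖ) :
    cellPart ϖ n (floquetAdjoint hϖ g) = (1 / (2 * Real.pi) : ℂ) •
      ∫ η, Complex.exp (Complex.I * pairing n η) • g η ∂floquetMeasure := by
  refine ext_inner_left ℂ fun h => ?_
  obtain ⟨e, rfl, he⟩ := hϖ.exists_cellPart_eq_single n h
  calc inner ℂ (cellPart ϖ n e) (cellPart ϖ n (floquetAdjoint hϖ g))
      = inner ℂ e (floquetAdjoint hϖ g) := by
        rw [inner_eq_tsum_cellPart hϖ, tsum_eq_single n fun m hm => by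
          rw [he m hm, inner_zero_left]]
    _ = inner ℂ (floquetMode ϖ n (cellPart ϖ n e)) g := by
        rw [inner_floquetAdjoint, floquetIsometry_eq_floquetMode hϖ he]
    _ = _ := by
        rw [floquetMode_apply, inner_smul_left, inner_mode, inner_smul_right,
          ← integral_inner (integrable_exp_smul (integrable_bochnerL2 g) n)]
        simp [inner_smul_right, map_ofNat]

theorem floquetAdjoint_ae_eq_floquetInv (hϖ : IsTilingCell ϖ) (g : BochnerL2 ϖ) :
    floquetAdjoint hϖ g =ᵐ[volume.restrict (periodicDomain ϖ)] floquetInv ϖ g := by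
  refine hϖ.ae_periodicDomain_iff.2 fun m => ?_
  filter_upwards [hϖ.cellPart_ae_eq m (.refl _ (floquetAdjoint hϖ g)),
    ae_restrict_mem hϖ.isOpen.measurableSet] with z hpart hz
  rw [← hpart, floquetInv, hϖ.tr_add_lat hz, hϖ.intPart_add_lat hz, cellPart_floquetAdjoint hϖ]

/-! ## Decaying functions and their lattice sums -/

/-- The functions of `A²(Ω)` whose norms on the cells are summable. They are the functions whose
Floquet series converges for every `η`. -/
def decaySpace (ϖ : Set ℂ) : Submodule ℂ (L2 (periodicDomain ϖ)) where
  carrier := {U | U ∈ bergmanSpace (periodicDomain ϖ) ∧ Summable fun m => ‖cellPart ϖ m U‖}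
  zero_mem' := by
    refine ⟨zero_mem _, summable_zero.congr fun m => ?_⟩
    rw [← zero_smul ℂ (0 : L2 (periodicDomain ϖ)), cellPart_smul, zero_smul, norm_zero]
  add_mem' := by
    rintro f g ⟨hf, hfs⟩ ⟨hg, hgs⟩
    refine ⟨add_mem hf hg, (hfs.add hgs).of_nonneg_of_le (fun _ => norm_nonneg _) fun m => ?_⟩
    rw [cellPart_add]
    exact norm_add_le _ _
  smul_mem' := by
    rintro c f ⟨hf, hfs⟩
    refine ⟨Submodule.smul_mem _ c hf, (hfs.mul_left ‖c‖).congr fun m => ?_⟩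
    rw [cellPart_smul, norm_smul]

theorem ae_eq_of_hasSum {α E ι : Type*} [MeasurableSpace α] {μ : Measure α} [NormedAddCommGroup E]
    [Countable ι] {F : ι → Lp E 2 μ} {S : Lp E 2 μ} (hF : HasSum F S) {f : ι → α → E}
    (hf : ∀ i, F i =ᵐ[μ] f i) {s : α → E} (hs : ∀ᵐ x ∂μ, HasSum (fun i => f i x) (s x)) :
    S =ᵐ[μ] s := by
  obtain ⟨ns, hns, hae⟩ := (tendstoInMeasure_of_tendsto_Lp hF).exists_seq_tendsto_ae'
  have hpartial : ∀ᵐ x ∂μ, ∀ n, (∑ i ∈ ns n, F i : Lp E 2 μ) x = ∑ i ∈ ns n, F i x :=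
    ae_all_iff.2 fun n => Lp.coeFn_fun_finsetSum (ns n) F
  filter_upwards [hae, ae_all_iff.2 hf, hpartial, hs] with x hlim hfx hpx hsx
  refine tendsto_nhds_unique hlim ?_
  simp only [hpx, hfx]
  exact hsx.comp hns

section LatticeSum

variable {U : L2 (periodicDomain ϖ)}

theorem norm_holoRep_le_sum_cellPart (hϖ : IsTilingCell ϖ)
    (hU : U ∈ bergmanSpace (periodicDomain ϖ)) {c : ℂ} {R : ℝ} (hR : 0 < R)
    (hball : Metric.ball c R ⊆ periodicDomain ϖ) {J : Finset (ℤ × ℤ)}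
    (hJ : ∀ y ∈ Metric.ball c R, intPart y ∈ J) :
    ‖holoRep (periodicDomain ϖ) U c‖ ≤ 2 / R * ∑ j ∈ J, ‖cellPart ϖ j U‖ := by
  obtain ⟨hdiff, hae⟩ := holoRep_spec (isOpen_periodicDomain ϖ) hU
  set u := holoRep (periodicDomain ϖ) U
  set B := Metric.ball c R
  have hB : MeasurableSet B := Metric.isOpen_ball.measurableSet
  have hsum : ENNReal.ofReal (R / 2) * ‖u c‖ₑ ≤ ∑ j ∈ J, ‖cellPart ϖ j U‖ₑ := by
    calc ENNReal.ofReal (R / 2) * ‖u c‖ₑ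
        ≤ eLpNorm u 2 (volume.restrict B) := enorm_le_eLpNorm_ball hR (hdiff.mono hball)
      _ = eLpNorm (B.indicator u) 2 (volume.restrict (periodicDomain ϖ)) := by
        rw [eLpNorm_indicator_eq_eLpNorm_restrict hB, Measure.restrict_restrict hB,
          inter_eq_left.2 hball]
      _ ≤ ∑' m, eLpNorm (fun z => B.indicator u (z + lat m)) 2 (volume.restrict ϖ) :=
        hϖ.eLpNorm_periodicDomain_le _
      _ = ∑ j ∈ J, eLpNorm (fun z => B.indicator u (z + lat j)) 2 (volume.restrict ϖ) := by
        refine tsum_eq_sum fun m hm => ?_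
        refine (eLpNorm_congr_ae ?_).trans eLpNorm_zero
        filter_upwards [ae_restrict_mem hϖ.isOpen.measurableSet] with z hz
        exact indicator_of_notMem (fun hzB => hm (hϖ.intPart_add_lat hz m ▸ hJ _ hzB)) _
      _ ≤ ∑ j ∈ J, ‖cellPart ϖ j U‖ₑ := by
        refine Finset.sum_le_sum fun j _ => ?_
        rw [Lp.enorm_def, eLpNorm_congr_ae (hϖ.cellPart_ae_eq j hae)]
        exact eLpNorm_mono_enorm fun z => enorm_indicator_le_enorm_self _ _
  have hreal := ENNReal.toReal_mono (ENNReal.sum_ne_top.2 fun _ _ => enorm_ne_top) hsum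
  rw [ENNReal.toReal_mul, ENNReal.toReal_ofReal (by positivity), toReal_enorm,
    ENNReal.toReal_sum fun _ _ => enorm_ne_top] at hreal
  simp only [toReal_enorm] at hreal
  calc ‖u c‖ = 2 / R * (R / 2 * ‖u c‖) := by field_simp
    _ ≤ 2 / R * ∑ j ∈ J, ‖cellPart ϖ j U‖ := by gcongr

theorem summable_norm_cellPart_add (hU : U ∈ decaySpace ϖ) (n : ℤ × ℤ) :
    Summable fun l => ‖cellPart ϖ (n + l) U‖ :=
  (Equiv.addLeft n).summable_iff.2 hU.2

theorem exists_summable_norm_add_lat_le (hϖ : IsTilingCell ϖ) (hU : U ∈ decaySpace ϖ) {z : ℂ}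
    (hz : z ∈ periodicDomain ϖ) :
    ∃ r > 0, Metric.ball z r ⊆ periodicDomain ϖ ∧ ∃ v : ℤ × ℤ → ℝ, Summable v ∧
      ∀ w ∈ Metric.ball z r, ∀ l, ‖holoRep (periodicDomain ϖ) U (w + lat l)‖ ≤ v l := by
  obtain ⟨R, hR, hzR⟩ := Metric.isOpen_iff.1 (isOpen_periodicDomain ϖ) z hz
  set J := (finite_intPart_image_ball z R).toFinset
  refine ⟨R / 2, by positivity, (Metric.ball_subset_ball (by linarith)).trans hzR,
    fun l => 2 / (R / 2) * ∑ j ∈ J, ‖cellPart ϖ (j + l) U‖,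
    (summable_sum fun j _ => summable_norm_cellPart_add hU j).mul_left _, fun w hw l => ?_⟩
  have hshift : ∀ y ∈ Metric.ball (w + lat l) (R / 2), y - lat l ∈ Metric.ball z R := by
    intro y hy
    rw [Metric.mem_ball] at *
    have hdist : dist (y - lat l) w = dist y (w + lat l) := by
      rw [dist_eq_norm, dist_eq_norm, sub_sub, add_comm w]
    linarith [dist_triangle (y - lat l) w z]
  have hball : Metric.ball (w + lat l) (R / 2) ⊆ periodicDomain ϖ := fun y hy =>
    (sub_lat_mem_periodicDomain l).1 (hzR (hshift y hy))
  refine (norm_holoRep_le_sum_cellPart hϖ hU.1 (by positivity) hball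
    (J := J.map (Equiv.addRight l).toEmbedding) fun y hy => ?_).trans_eq (by simp)
  rw [← sub_add_cancel y (lat l), intPart_add_lat]
  exact Finset.mem_map_of_mem _ ((Finite.mem_toFinset _).2 ⟨_, hshift y hy, rfl⟩)

variable {c : ℤ × ℤ → ℂ} {B : ℝ} (hU : U ∈ decaySpace ϖ) (hc : ∀ l, ‖c l‖ ≤ B)

include hU hc

theorem summable_smul_cellPart (n : ℤ × ℤ) : Summable fun l => c l • cellPart ϖ (n + l) U := by
  refine Summable.of_norm_bounded ((summable_norm_cellPart_add hU n).mul_left B) fun l => ?_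
  rw [norm_smul]
  gcongr
  exact hc l

variable (hϖ : IsTilingCell ϖ)

include hϖ

theorem summable_mul_holoRep_add_lat {z : ℂ} (hz : z ∈ periodicDomain ϖ) :
    Summable fun l => c l * holoRep (periodicDomain ϖ) U (z + lat l) := by
  obtain ⟨r, hr, -, v, hv, hle⟩ := exists_summable_norm_add_lat_le hϖ hU hz
  refine Summable.of_norm_bounded (hv.mul_left B) fun l => ?_
  rw [norm_mul]
  exact mul_le_mul (hc l) (hle z (Metric.mem_ball_self hr) l) (norm_nonneg _)
    ((norm_nonneg _).trans (hc l))

theorem differentiableOn_latticeSum :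
    DifferentiableOn ℂ (fun z => ∑' l, c l * holoRep (periodicDomain ϖ) U (z + lat l))
      (periodicDomain ϖ) := by
  intro z hz
  obtain ⟨r, hr, hball, v, hv, hle⟩ := exists_summable_norm_add_lat_le hϖ hU hz
  refine ((Complex.differentiableOn_tsum_of_summable_norm (hv.mul_left B) (fun l => ?_)
    Metric.isOpen_ball fun l w hw => ?_).differentiableAt
      (Metric.ball_mem_nhds z hr)).differentiableWithinAt
  · exact ((holoRep_spec (isOpen_periodicDomain ϖ) hU.1).1.comp (by fun_prop) fun w hw =>
      (add_lat_mem_periodicDomain l).2 (hball hw)).const_mul _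
  · rw [norm_mul]
    exact mul_le_mul (hc l) (hle w hw l) (norm_nonneg _) ((norm_nonneg _).trans (hc l))

theorem tsum_smul_cellPart_ae_eq (n : ℤ × ℤ) :
    (∑' l, c l • cellPart ϖ (n + l) U : L2 ϖ) =ᵐ[volume.restrict ϖ]
      fun z => ∑' l, c l * holoRep (periodicDomain ϖ) U (z + lat n + lat l) := by
  refine ae_eq_of_hasSum (summable_smul_cellPart hU hc n).hasSum
    (f := fun l z => c l * holoRep (periodicDomain ϖ) U (z + lat n + lat l)) (fun l => ?_) ?_
  · filter_upwards [Lp.coeFn_smul (c l) (cellPart ϖ (n + l) U),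
      hϖ.cellPart_ae_eq (n + l) (holoRep_spec (isOpen_periodicDomain ϖ) hU.1).2] with z hsmul hz
    rw [hsmul, Pi.smul_apply, hz, smul_eq_mul, lat_add, add_assoc]
  · filter_upwards [ae_restrict_mem hϖ.isOpen.measurableSet] with z hz
    exact (summable_mul_holoRep_add_lat hU hc hϖ (hϖ.add_lat_mem hz n)).hasSum

end LatticeSum

/-! ## Density of the decaying functions -/

theorem IsTilingCell.norm_cellPart_le (hϖ : IsTilingCell ϖ) (m : ℤ × ℤ)
    (f : L2 (periodicDomain ϖ)) : ‖cellPart ϖ m f‖ ≤ ‖f‖ :=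
  (sq_le_sq₀ (norm_nonneg _) (norm_nonneg _)).1 <|
    le_hasSum (hϖ.hasSum_norm_sq_cellPart f) m fun _ _ => sq_nonneg _

theorem exists_mem_decaySpace_ae_eq_mul (hϖ : IsTilingCell ϖ) {Ψ G : ℂ → ℂ} {a : ℤ × ℤ → ℝ}
    (hΨ : DifferentiableOn ℂ Ψ (periodicDomain ϖ)) (ha : Summable a)
    (hΨa : ∀ m, ∀ᵐ z ∂(volume.restrict ϖ), ‖Ψ (z + lat m)‖ ≤ a m)
    (hG : DifferentiableOn ℂ G (periodicDomain ϖ)) {K : ℝ≥0∞} (hK : K ≠ ∞)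
    (hGK : ∀ m, eLpNorm (fun z => G (z + lat m)) 2 (volume.restrict ϖ) ≤ K) :
    ∃ U ∈ decaySpace ϖ, U =ᵐ[volume.restrict (periodicDomain ϖ)] fun z => G z * Ψ z := by
  have hdiff : DifferentiableOn ℂ (fun z => G z * Ψ z) (periodicDomain ϖ) := hG.mul hΨ
  have hcell : ∀ m, eLpNorm (fun z => G (z + lat m) * Ψ (z + lat m)) 2 (volume.restrict ϖ) ≤
      ENNReal.ofReal (a m) * K := fun m => by
    refine (eLpNorm_le_mul_eLpNorm_of_ae_le_mul ?_ 2).trans (mul_le_mul_right (hGK m) _)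
    filter_upwards [hΨa m] with z hz
    rw [norm_mul, mul_comm]
    gcongr
  have hfin : ∑' m, ENNReal.ofReal (a m) * K ≠ ∞ := by
    rw [ENNReal.tsum_mul_right]
    exact ENNReal.mul_ne_top ha.tsum_ofReal_ne_top hK
  have hnorm : eLpNorm (fun z => G z * Ψ z) 2 (volume.restrict (periodicDomain ϖ)) ≤
      ∑' m, ENNReal.ofReal (a m) * K :=
    (hϖ.eLpNorm_periodicDomain_le fun z => G z * Ψ z).trans (ENNReal.tsum_le_tsum hcell)
  have hmem : MemLp (fun z => G z * Ψ z) 2 (volume.restrict (periodicDomain ϖ)) :=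
    ⟨hdiff.continuousOn.aestronglyMeasurable (isOpen_periodicDomain ϖ).measurableSet,
      hnorm.trans_lt hfin.lt_top⟩
  refine ⟨hmem.toLp, ⟨mem_bergmanSpace hdiff hmem.coeFn_toLp, ?_⟩, hmem.coeFn_toLp⟩
  refine (ENNReal.summable_toReal hfin).of_nonneg_of_le (fun _ => norm_nonneg _) fun m => ?_
  rw [← toReal_enorm, Lp.enorm_def, eLpNorm_congr_ae (hϖ.cellPart_ae_eq m hmem.coeFn_toLp)]
  exact ENNReal.toReal_mono (ENNReal.mul_ne_top ENNReal.ofReal_ne_top hK) (hcell m)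

theorem tendsto_L2_of_dominated {α E ι : Type*} [MeasurableSpace α] {μ : Measure α}
    [NormedAddCommGroup E] {l : Filter ι} [l.IsCountablyGenerated] {F : ι → Lp E 2 μ} {f : Lp E 2 μ}
    {bound : α → ℝ} (hbound : MemLp bound 2 μ) (hF : ∀ i, ∀ᵐ x ∂μ, ‖F i x‖ ≤ bound x)
    (hlim : ∀ᵐ x ∂μ, Tendsto (fun i => F i x) l (𝓝 (f x))) : Tendsto F l (𝓝 f) := by
  have hdom : MemLp (fun x => bound x + ‖f x‖) 2 μ := hbound.add (Lp.memLp f).norm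
  have hsq : Tendsto (fun i => ∫⁻ x, ‖F i x - f x‖ₑ ^ 2 ∂μ) l (𝓝 (∫⁻ _, 0 ∂μ)) := by
    refine tendsto_lintegral_filter_of_dominated_convergence
      (fun x => ‖bound x + ‖f x‖‖ₑ ^ 2) (Eventually.of_forall fun i => ?_)
      (Eventually.of_forall fun i => ?_) ?_ ?_
    · exact ((Lp.stronglyMeasurable _).sub (Lp.stronglyMeasurable _)).enorm.pow_const 2
    · filter_upwards [hF i] with x hx
      gcongr
      rw [enorm_le_iff_norm_le]
      exact (norm_sub_le _ _).trans ((add_le_add_left hx _).trans (le_abs_self _))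
    · rw [← eLpNorm_two_sq]
      exact ENNReal.pow_ne_top hdom.2.ne
    · filter_upwards [hlim] with x hx
      have hzero := (hx.sub_const (f x)).enorm
      rw [sub_self, enorm_zero] at hzero
      simpa [Function.comp_def] using (ENNReal.continuous_pow 2).continuousAt.tendsto.comp hzero
  rw [Lp.tendsto_Lp_iff_tendsto_eLpNorm']
  simp only [lintegral_zero, ← eLpNorm_two_sq] at hsq
  have hroot := (ENNReal.continuous_rpow_const (y := (1 / 2 : ℝ))).continuousAt.tendsto.comp hsq
  refine (hroot.congr fun i => ?_).trans_eq (by simp)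
  rw [Function.comp_apply, ← ENNReal.rpow_natCast, ← ENNReal.rpow_mul]
  norm_num
  rfl

theorem IsDecayingPartition.bergmanSpace_le_closure_decaySpace {Ψ : ℂ → ℂ}
    {a : ℤ × ℤ → ℝ} (hΨ : IsDecayingPartition ϖ Ψ a) (hϖ : IsTilingCell ϖ) :
    bergmanSpace (periodicDomain ϖ) ≤ (decaySpace ϖ).topologicalClosure := by
  rintro f ⟨g, hg, hfg⟩
  have hbound : ∀ m, ∀ᵐ z ∂(volume.restrict ϖ), ∀ p, ‖Ψ (z + lat m + lat p)‖ ≤ a (m + p) :=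
    fun m => ae_all_iff.2 fun p => by simpa only [lat_add, add_assoc] using hΨ.norm_le (m + p)
  have hexists : ∀ p, ∃ U ∈ decaySpace ϖ,
      U =ᵐ[volume.restrict (periodicDomain ϖ)] fun z => g z * Ψ (z + lat p) := fun p =>
    exists_mem_decaySpace_ae_eq_mul hϖ
      (hΨ.differentiableOn.comp (by fun_prop) fun z hz => (add_lat_mem_periodicDomain p).2 hz)
      ((Equiv.addRight p).summable_iff.2 hΨ.summable) (fun m => (hbound m).mono fun z hz => hz p)
      hg (K := ‖f‖ₑ) enorm_ne_top fun m => by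
        rw [← eLpNorm_congr_ae (hϖ.cellPart_ae_eq m hfg), ← Lp.enorm_def, enorm_le_iff_norm_le]
        exact hϖ.norm_cellPart_le m f
  choose U hU hUg using hexists
  have hsum : ∀ s : Finset (ℤ × ℤ), (∑ p ∈ s, U p : L2 (periodicDomain ϖ))
      =ᵐ[volume.restrict (periodicDomain ϖ)] fun z => f z * ∑ p ∈ s, Ψ (z + lat p) := fun s => by
    filter_upwards [Lp.coeFn_fun_finsetSum s U, ae_all_iff.2 hUg, hfg] with z hz hUz hfz
    simp only [hz, hUz, hfz, Finset.mul_sum]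
  have hle : ∀ s : Finset (ℤ × ℤ), ∀ᵐ z ∂(volume.restrict (periodicDomain ϖ)),
      ‖∑ p ∈ s, Ψ (z + lat p)‖ ≤ ∑' m, a m := fun s =>
    hϖ.ae_periodicDomain_iff.2 fun m => (hbound m).mono fun z hz =>
      (norm_sum_le_of_le s fun p _ => hz p).trans (sum_le_hasSum s (fun p _ => hΨ.nonneg _)
        ((Equiv.addLeft m).hasSum_iff.2 hΨ.summable.hasSum))
  have hone : ∀ᵐ z ∂(volume.restrict (periodicDomain ϖ)), HasSum (fun p => Ψ (z + lat p)) 1 :=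
    hϖ.ae_periodicDomain_iff.2 fun m => hΨ.hasSum.mono fun z hz => by
      simpa only [Function.comp_def, Equiv.coe_addLeft, lat_add, add_assoc] using
        (Equiv.addLeft m).hasSum_iff.2 hz
  refine mem_closure_of_tendsto (b := atTop) (f := fun s : Finset (ℤ × ℤ) => ∑ p ∈ s, U p) ?_
    (Eventually.of_forall fun s => sum_mem fun p _ => hU p)
  refine tendsto_L2_of_dominated ((Lp.memLp f).norm.mul_const (∑' m, a m)) (fun s => ?_) ?_
  · filter_upwards [hsum s, hle s] with z hz hlez
    rw [hz, norm_mul]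
    gcongr
  · filter_upwards [ae_all_iff.2 hsum, hone] with z hz honez
    have hlim : Tendsto (fun s : Finset (ℤ × ℤ) => ∑ p ∈ s, Ψ (z + lat p)) atTop (𝓝 1) := honez
    simpa only [hz, mul_one] using hlim.const_mul (f z)

/-! ## Floquet series as continuous sections -/

/-- The Floquet series of `U`, without the factor `(2π)⁻¹`, as a function of `η` defined at every
point; the sum converges in `L²(ϖ)` when the norms of `U` on the cells are summable. -/
def floquetSeries (ϖ : Set ℂ) (U : L2 (periodicDomain ϖ)) (η : ℝ × ℝ) : L2 ϖ :=
  ∑' l : ℤ × ℤ, Complex.exp (-(Complex.I * pairing l η)) • cellPart ϖ l U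

theorem norm_exp_neg_I_mul (x : ℝ) : ‖Complex.exp (-(Complex.I * x))‖ = 1 := by
  rw [Complex.norm_exp]
  simp

section FloquetSeries

variable {U : L2 (periodicDomain ϖ)}

theorem exp_smul_floquetSeries (U : L2 (periodicDomain ϖ)) (n : ℤ × ℤ) (η : ℝ × ℝ) :
    Complex.exp (Complex.I * pairing n η) • floquetSeries ϖ U η =
      ∑' l, Complex.exp (-(Complex.I * pairing l η)) • cellPart ϖ (n + l) U := by
  rw [floquetSeries, ← tsum_const_smul'', ← (Equiv.addLeft n).tsum_eq]
  refine tsum_congr fun l => ?_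
  rw [Equiv.coe_addLeft, smul_smul, ← Complex.exp_add, pairing_add]
  congr 2
  push_cast
  ring

theorem hasSum_floquetSeries (hU : Summable fun m => ‖cellPart ϖ m U‖) (η : ℝ × ℝ) :
    HasSum (fun l => Complex.exp (-(Complex.I * pairing l η)) • cellPart ϖ l U)
      (floquetSeries ϖ U η) :=
  (Summable.of_norm_bounded hU fun l => by rw [norm_smul, norm_exp_neg_I_mul, one_mul]).hasSum

theorem norm_floquetSeries_le (hU : Summable fun m => ‖cellPart ϖ m U‖) (η : ℝ × ℝ) :
    ‖floquetSeries ϖ U η‖ ≤ ∑' m, ‖cellPart ϖ m U‖ :=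
  tsum_of_norm_bounded hU.hasSum fun l => by rw [norm_smul, norm_exp_neg_I_mul, one_mul]

theorem continuous_floquetSeries (hU : Summable fun m => ‖cellPart ϖ m U‖) :
    Continuous (floquetSeries ϖ U) :=
  continuous_tsum (fun l => by fun_prop) hU fun l η => by
    rw [norm_smul, norm_exp_neg_I_mul, one_mul]

theorem memLp_indicator_floquetSeries (hU : Summable fun m => ‖cellPart ϖ m U‖) {A : Set (ℝ × ℝ)}
    (hA : MeasurableSet A) : MemLp (A.indicator (floquetSeries ϖ U)) 2 floquetMeasure :=
  (MemLp.of_bound (continuous_floquetSeries hU).aestronglyMeasurable _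
    (Eventually.of_forall (norm_floquetSeries_le hU))).indicator hA

theorem floquetIsometry_ae_eq_floquetSeries (hϖ : IsTilingCell ϖ)
    (hU : Summable fun m => ‖cellPart ϖ m U‖) :
    floquetIsometry hϖ U =ᵐ[floquetMeasure] fun η =>
      (1 / (2 * Real.pi) : ℂ) • floquetSeries ϖ U η := by
  refine ae_eq_of_hasSum (hasSum_floquetIsometry hϖ U) (f := fun l η =>
    (1 / (2 * Real.pi) : ℂ) • Complex.exp (-(Complex.I * pairing l η)) • cellPart ϖ l U)
    (fun l => ?_) (Eventually.of_forall fun η => (hasSum_floquetSeries hU η).const_smul _)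
  rw [floquetMode_apply]
  filter_upwards [Lp.coeFn_smul (1 / (2 * Real.pi) : ℂ) (memLp_mode ϖ l (cellPart ϖ l U)).toLp,
    (memLp_mode ϖ l (cellPart ϖ l U)).coeFn_toLp] with η hsmul hmode
  rw [hsmul, Pi.smul_apply, hmode]

theorem floquetSeries_mem_quasiExt (hϖ : IsTilingCell ϖ) (hU : U ∈ decaySpace ϖ) (η : ℝ × ℝ) :
    floquetSeries ϖ U η ∈ quasiExt ϖ η := by
  have hc : ∀ l, ‖Complex.exp (-(Complex.I * pairing l η))‖ ≤ 1 := fun l =>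
    (norm_exp_neg_I_mul _).le
  refine (mem_quasiExt_iff hϖ.toIsCell).2 ⟨_, differentiableOn_latticeSum hU hc hϖ, ?_,
    fun z m => ?_⟩
  · simpa only [floquetSeries, zero_add, lat_zero, add_zero] using
      tsum_smul_cellPart_ae_eq hU hc hϖ 0
  · beta_reduce
    rw [← (Equiv.addRight m).tsum_eq (fun l => Complex.exp (-(Complex.I * pairing l η)) *
      holoRep (periodicDomain ϖ) U (z + lat l)), ← tsum_mul_left]
    refine tsum_congr fun l => ?_
    rw [Equiv.coe_addRight, ← mul_assoc, ← Complex.exp_add, pairing_add, lat_add, add_assoc,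
      add_comm (lat m)]
    congr 2
    push_cast
    ring

theorem IsDecayingPartition.exists_floquetSeries_eq {Ψ : ℂ → ℂ} {a : ℤ × ℤ → ℝ}
    (hΨ : IsDecayingPartition ϖ Ψ a) (hϖ : IsTilingCell ϖ) {η : ℝ × ℝ} {f : L2 ϖ}
    (hf : f ∈ quasiExt ϖ η) : ∃ U ∈ decaySpace ϖ, floquetSeries ϖ U η = f := by
  obtain ⟨G, hG, hfG, hper⟩ := (mem_quasiExt_iff hϖ.toIsCell).1 hf
  obtain ⟨U, hU, hUG⟩ := exists_mem_decaySpace_ae_eq_mul hϖ hΨ.differentiableOn hΨ.summable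
    hΨ.norm_le hG (K := ‖f‖ₑ) enorm_ne_top fun m => by
      rw [Lp.enorm_def, eLpNorm_congr_ae hfG]
      refine eLpNorm_mono fun z => ?_
      rw [hper, norm_mul, norm_exp_I_mul, one_mul]
  refine ⟨U, hU, Lp.ext ((ae_eq_of_hasSum (hasSum_floquetSeries hU.2 η)
    (f := fun l z => G z * Ψ (z + lat l)) (fun l => ?_) ?_).trans hfG.symm)⟩
  · filter_upwards [Lp.coeFn_smul (Complex.exp (-(Complex.I * pairing l η))) (cellPart ϖ l U),
      hϖ.cellPart_ae_eq l hUG] with z hsmul hz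
    rw [hsmul, Pi.smul_apply, hz, hper, smul_eq_mul, ← mul_assoc, ← mul_assoc, ← Complex.exp_add,
      neg_add_cancel, Complex.exp_zero, one_mul]
  · filter_upwards [hΨ.hasSum] with z hz
    simpa only [mul_one] using hz.mul_left (G z)

/-- The Floquet series of a function with summable norms on the cells, cut off to a measurable set
of parameters. -/
def floquetSection (hU : Summable fun m => ‖cellPart ϖ m U‖) {A : Set (ℝ × ℝ)}
    (hA : MeasurableSet A) : BochnerL2 ϖ :=
  (memLp_indicator_floquetSeries hU hA).toLp

theorem floquetSection_ae_eq (hU : Summable fun m => ‖cellPart ϖ m U‖) {A : Set (ℝ × ℝ)}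
    (hA : MeasurableSet A) :
    floquetSection hU hA =ᵐ[floquetMeasure] A.indicator (floquetSeries ϖ U) :=
  MemLp.coeFn_toLp _

theorem floquetSection_mem_fiberSpace (hϖ : IsTilingCell ϖ) (hU : U ∈ decaySpace ϖ)
    {A : Set (ℝ × ℝ)} (hA : MeasurableSet A) : floquetSection hU.2 hA ∈ fiberSpace ϖ := by
  change ∀ᵐ η ∂floquetMeasure, floquetSection hU.2 hA η ∈ quasiSpace ϖ η
  filter_upwards [floquetSection_ae_eq hU.2 hA] with η hη
  rw [hη]
  by_cases hηA : η ∈ A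
  · rw [indicator_of_mem hηA]
    exact Submodule.le_topologicalClosure _ (floquetSeries_mem_quasiExt hϖ hU η)
  · rw [indicator_of_notMem hηA]
    exact zero_mem _

theorem inner_floquetSection (hU : Summable fun m => ‖cellPart ϖ m U‖) {A : Set (ℝ × ℝ)}
    (hA : MeasurableSet A) (h : BochnerL2 ϖ) : inner ℂ (floquetSection hU hA) h =
      ∫ η in A, inner ℂ (floquetSeries ϖ U η) (h η) ∂floquetMeasure := by
  rw [L2.inner_def, ← integral_indicator hA]
  refine integral_congr_ae ?_
  filter_upwards [floquetSection_ae_eq hU hA] with η hη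
  rw [hη]
  by_cases hηA : η ∈ A
  · rw [indicator_of_mem hηA, indicator_of_mem hηA]
  · rw [indicator_of_notMem hηA, indicator_of_notMem hηA, inner_zero_left]

theorem setIntegral_exp_smul_floquetSeries (hU : Summable fun m => ‖cellPart ϖ m U‖)
    (A : Set (ℝ × ℝ)) (n : ℤ × ℤ) :
    ∫ η in A, Complex.exp (Complex.I * pairing n η) • floquetSeries ϖ U η ∂floquetMeasure =
      ∑' l, (∫ η in A, Complex.exp (-(Complex.I * pairing l η)) ∂floquetMeasure) •
        cellPart ϖ (n + l) U := by
  have hint : ∀ l, Integrable (fun η => Complex.exp (-(Complex.I * pairing l η)))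
      (floquetMeasure.restrict A) := fun l =>
    Integrable.of_bound (Continuous.aestronglyMeasurable (by fun_prop)) 1
      (Eventually.of_forall fun η => (norm_exp_neg_I_mul _).le)
  have hsum : Summable fun l => ∫ η in A,
      ‖Complex.exp (-(Complex.I * pairing l η)) • cellPart ϖ (n + l) U‖ ∂floquetMeasure := by
    simp only [norm_smul, norm_exp_neg_I_mul, one_mul, integral_const, smul_eq_mul]
    exact ((Equiv.addLeft n).summable_iff.2 hU).mul_left _
  simp only [exp_smul_floquetSeries]
  rw [← (hasSum_integral_of_summable_integral_norm (fun l => (hint l).smul_const _) hsum).tsum_eq]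
  exact tsum_congr fun l => integral_smul_const _ _

theorem cellPart_floquetAdjoint_floquetSection (hϖ : IsTilingCell ϖ)
    (hU : Summable fun m => ‖cellPart ϖ m U‖) {A : Set (ℝ × ℝ)} (hA : MeasurableSet A)
    (n : ℤ × ℤ) : cellPart ϖ n (floquetAdjoint hϖ (floquetSection hU hA)) =
      ∑' l, (1 / (2 * Real.pi) *
        ∫ η in A, Complex.exp (-(Complex.I * pairing l η)) ∂floquetMeasure : ℂ) •
          cellPart ϖ (n + l) U := by
  have hsection : ∫ η, Complex.exp (Complex.I * pairing n η) • floquetSection hU hA η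
      ∂floquetMeasure =
      ∫ η in A, Complex.exp (Complex.I * pairing n η) • floquetSeries ϖ U η ∂floquetMeasure := by
    rw [← integral_indicator hA]
    refine integral_congr_ae ?_
    filter_upwards [floquetSection_ae_eq hU hA] with η hη
    rw [hη, indicator_smul_apply]
  simp only [mul_smul]
  rw [tsum_const_smul'', cellPart_floquetAdjoint, hsection, setIntegral_exp_smul_floquetSeries hU]

theorem floquetAdjoint_floquetSection_mem (hϖ : IsTilingCell ϖ) (hU : U ∈ decaySpace ϖ)
    {A : Set (ℝ × ℝ)} (hA : MeasurableSet A) :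
    floquetAdjoint hϖ (floquetSection hU.2 hA) ∈ bergmanSpace (periodicDomain ϖ) := by
  have hbound : ∀ l, ‖(1 / (2 * Real.pi) *
      ∫ η in A, Complex.exp (-(Complex.I * pairing l η)) ∂floquetMeasure : ℂ)‖ ≤
      ‖(1 / (2 * Real.pi) : ℂ)‖ * (1 * (floquetMeasure.restrict A).real univ) := fun l => by
    rw [norm_mul]
    gcongr
    exact norm_integral_le_of_norm_le_const
      (Eventually.of_forall fun η => (norm_exp_neg_I_mul _).le)
  refine mem_bergmanSpace (differentiableOn_latticeSum hU hbound hϖ) <|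
    hϖ.ae_periodicDomain_iff.2 fun n => ?_
  filter_upwards [tsum_smul_cellPart_ae_eq hU hbound hϖ n,
    hϖ.cellPart_ae_eq n (.refl _ (floquetAdjoint hϖ (floquetSection hU.2 hA)))] with z hsum hpart
  rw [← hpart, cellPart_floquetAdjoint_floquetSection, hsum]

end FloquetSeries

/-! ## The fibrewise projection -/

theorem ae_forall_mem_of_forall_ae_mem {X E : Type*} [TopologicalSpace X]
    [SecondCountableTopology X] [LocallyCompactSpace X] [MeasurableSpace X] {μ : Measure X}
    [TopologicalSpace E] [SecondCountableTopology E] {K : X → Set E} (hK : ∀ x, IsClosed (K x))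
    {S : Set C(X, E)} (hS : ∀ s ∈ S, ∀ᵐ x ∂μ, s x ∈ K x) : ∀ᵐ x ∂μ, ∀ s ∈ S, s x ∈ K x := by
  obtain ⟨T, hT, hdense⟩ := TopologicalSpace.exists_countable_dense ↥S
  filter_upwards [(ae_ball_iff hT).2 fun s _ => hS s s.2] with x hx s hs
  have hclosed : IsClosed {t : S | t.1 x ∈ K x} :=
    (hK x).preimage ((continuous_eval_const (F := C(X, E)) x).comp continuous_subtype_val)
  exact closure_minimal (fun t ht => hx t ht) hclosed (hdense ⟨s, hs⟩)

theorem map_starProjection_of_mem_of_mem_orthogonal {𝕜 E F : Type*} [RCLike 𝕜]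
    [NormedAddCommGroup E] [InnerProductSpace 𝕜 E] [NormedAddCommGroup F] [InnerProductSpace 𝕜 F]
    {K : Submodule 𝕜 E} [K.HasOrthogonalProjection] {K' : Submodule 𝕜 F}
    [K'.HasOrthogonalProjection] {T : E →ₗ[𝕜] F} (hK : ∀ x ∈ K, T x ∈ K')
    (hK' : ∀ x ∈ Kᗮ, T x ∈ K'ᗮ) (x : E) : T (K.starProjection x) = K'.starProjection (T x) := by
  refine (Submodule.eq_starProjection_of_mem_orthogonal
    (hK _ (Submodule.starProjection_apply_mem _ x)) ?_).symm
  rw [← map_sub]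
  exact hK' _ (Submodule.sub_starProjection_mem_orthogonal x)

theorem mem_orthogonal_fiberSpace_of_ae {h : BochnerL2 ϖ}
    (hh : ∀ᵐ η ∂floquetMeasure, h η ∈ (quasiSpace ϖ η)ᗮ) : h ∈ (fiberSpace ϖ)ᗮ := by
  refine (Submodule.mem_orthogonal _ _).2 fun g (hg : ∀ᵐ η ∂floquetMeasure, g η ∈ _) => ?_
  rw [L2.inner_def, integral_eq_zero_of_ae]
  filter_upwards [hh, hg] with η hη hgη
  exact Submodule.inner_right_of_mem_orthogonal hgη hη

section FiberProjection

variable (hϖ : IsTilingCell ϖ) {Ψ : ℂ → ℂ} {a : ℤ × ℤ → ℝ} (hΨ : IsDecayingPartition ϖ Ψ a)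

include hϖ hΨ

theorem ae_mem_orthogonal_quasiSpace_of_inner_floquetSection {h : BochnerL2 ϖ}
    (hh : ∀ (U : L2 (periodicDomain ϖ)) (hU : U ∈ decaySpace ϖ) (A : Set (ℝ × ℝ))
      (hA : MeasurableSet A), inner ℂ (floquetSection hU.2 hA) h = 0) :
    ∀ᵐ η ∂floquetMeasure, h η ∈ (quasiSpace ϖ η)ᗮ := by
  have hseries : ∀ U ∈ decaySpace ϖ,
      ∀ᵐ η ∂floquetMeasure, inner ℂ (floquetSeries ϖ U η) (h η) = 0 := fun U hU => by
    have hint : Integrable (fun η => inner ℂ (floquetSeries ϖ U η) (h η)) floquetMeasure := by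
      refine (L2.integrable_inner (𝕜 := ℂ) (floquetSection hU.2 .univ) h).congr ?_
      filter_upwards [floquetSection_ae_eq hU.2 .univ] with η hη
      rw [hη, indicator_univ]
    refine hint.ae_eq_zero_of_forall_setIntegral_eq_zero fun A hA _ => ?_
    rw [← inner_floquetSection hU.2 hA, hh U hU A hA]
  have : Fact ((2 : ℝ≥0∞) ≠ ∞) := ⟨ENNReal.ofNat_ne_top⟩
  have hall := ae_forall_mem_of_forall_ae_mem (μ := floquetMeasure)
    (K := fun η => {v : L2 ϖ | inner ℂ v (h η) = 0})
    (S := {s | ∃ U ∈ decaySpace ϖ, ⇑s = floquetSeries ϖ U})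
    (fun η => isClosed_eq (by fun_prop) continuous_const)
    (by rintro s ⟨U, hU, hs⟩; simpa only [hs, mem_ofPred_eq] using hseries U hU)
  filter_upwards [hall] with η hη
  rw [quasiSpace, Submodule.orthogonal_closure, Submodule.mem_orthogonal]
  intro v hv
  obtain ⟨U, hU, rfl⟩ := hΨ.exists_floquetSeries_eq hϖ hv
  exact hη ⟨_, continuous_floquetSeries hU.2⟩ ⟨U, hU, rfl⟩

theorem ae_mem_orthogonal_quasiSpace {h : BochnerL2 ϖ} (hh : h ∈ (fiberSpace ϖ)ᗮ) :
    ∀ᵐ η ∂floquetMeasure, h η ∈ (quasiSpace ϖ η)ᗮ :=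
  ae_mem_orthogonal_quasiSpace_of_inner_floquetSection hϖ hΨ fun _ hU _ hA =>
    Submodule.inner_right_of_mem_orthogonal (floquetSection_mem_fiberSpace hϖ hU hA) hh

theorem starProjection_fiberSpace_ae_eq (g : BochnerL2 ϖ) :
    (fiberSpace ϖ).starProjection g =ᵐ[floquetMeasure] fun η => cellProj ϖ η (g η) := by
  have hmem : ∀ᵐ η ∂floquetMeasure, (fiberSpace ϖ).starProjection g η ∈ quasiSpace ϖ η :=
    Submodule.starProjection_apply_mem (fiberSpace ϖ) g
  filter_upwards [hmem, ae_mem_orthogonal_quasiSpace hϖ hΨ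
    (Submodule.sub_starProjection_mem_orthogonal g),
    Lp.coeFn_sub g ((fiberSpace ϖ).starProjection g)] with η hη horth hsub
  rw [hsub] at horth
  exact (Submodule.eq_starProjection_of_mem_orthogonal hη horth).symm

theorem memLp_cellProj (g : BochnerL2 ϖ) :
    MemLp (fun η => cellProj ϖ η (g η)) 2 floquetMeasure :=
  (Lp.memLp _).ae_eq (starProjection_fiberSpace_ae_eq hϖ hΨ g)

theorem fiberProj_eq_starProjection (g : BochnerL2 ϖ) :
    fiberProj ϖ g = (fiberSpace ϖ).starProjection g := by
  rw [fiberProj, dif_pos (memLp_cellProj hϖ hΨ g)]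
  exact Lp.ext ((memLp_cellProj hϖ hΨ g).coeFn_toLp.trans
    (starProjection_fiberSpace_ae_eq hϖ hΨ g).symm)

theorem floquetIsometry_mem_fiberSpace {f : L2 (periodicDomain ϖ)}
    (hf : f ∈ bergmanSpace (periodicDomain ϖ)) : floquetIsometry hϖ f ∈ fiberSpace ϖ := by
  have hclosed : IsClosed (fiberSpace ϖ : Set (BochnerL2 ϖ)) :=
    isClosed_fiber (K := fun η => (quasiSpace ϖ η : Set (L2 ϖ)))
      fun _ => Submodule.isClosed_topologicalClosure _
  refine closure_minimal (s := (decaySpace ϖ : Set (L2 (periodicDomain ϖ))))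
    (t := floquetIsometry hϖ ⁻¹' fiberSpace ϖ) (fun U hU => ?_)
    (hclosed.preimage (floquetIsometry hϖ).continuous)
    (hΨ.bergmanSpace_le_closure_decaySpace hϖ hf)
  change ∀ᵐ η ∂floquetMeasure, floquetIsometry hϖ U η ∈ quasiSpace ϖ η
  filter_upwards [floquetIsometry_ae_eq_floquetSeries hϖ hU.2] with η hη
  rw [hη]
  exact Submodule.smul_mem _ _
    (Submodule.le_topologicalClosure _ (floquetSeries_mem_quasiExt hϖ hU η))

theorem floquetIsometry_mem_orthogonal {f : L2 (periodicDomain ϖ)}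
    (hf : f ∈ (bergmanSpace (periodicDomain ϖ))ᗮ) :
    floquetIsometry hϖ f ∈ (fiberSpace ϖ)ᗮ := by
  refine mem_orthogonal_fiberSpace_of_ae <|
    ae_mem_orthogonal_quasiSpace_of_inner_floquetSection hϖ hΨ fun U hU A hA => ?_
  rw [← inner_conj_symm, ← inner_floquetAdjoint, inner_conj_symm]
  exact Submodule.inner_right_of_mem_orthogonal (floquetAdjoint_floquetSection_mem hϖ hU hA) hf

theorem floquetAdjoint_mem_bergmanSpace {g : BochnerL2 ϖ} (hg : g ∈ fiberSpace ϖ) :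
    floquetAdjoint hϖ g ∈ bergmanSpace (periodicDomain ϖ) := by
  have := hasOrthogonalProjection_bergmanSpace (isOpen_periodicDomain ϖ)
  rw [← Submodule.orthogonal_orthogonal (bergmanSpace (periodicDomain ϖ)),
    Submodule.mem_orthogonal]
  intro f hf
  rw [inner_floquetAdjoint]
  exact Submodule.inner_left_of_mem_orthogonal hg (floquetIsometry_mem_orthogonal hϖ hΨ hf)

theorem floquetIsometry_bergmanProj (f : L2 (periodicDomain ϖ)) :
    floquetIsometry hϖ (bergmanProj (periodicDomain ϖ) (isOpen_periodicDomain ϖ) f) =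
      (fiberSpace ϖ).starProjection (floquetIsometry hϖ f) :=
  have := hasOrthogonalProjection_bergmanSpace (isOpen_periodicDomain ϖ)
  map_starProjection_of_mem_of_mem_orthogonal (T := (floquetIsometry hϖ).toLinearMap)
    (fun _ => floquetIsometry_mem_fiberSpace hϖ hΨ)
    (fun _ => floquetIsometry_mem_orthogonal hϖ hΨ) f

theorem bergmanProj_eq_floquetAdjoint (f : L2 (periodicDomain ϖ)) :
    bergmanProj (periodicDomain ϖ) (isOpen_periodicDomain ϖ) f =
      floquetAdjoint hϖ ((fiberSpace ϖ).starProjection (floquetIsometry hϖ f)) := by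
  rw [← floquetIsometry_bergmanProj hϖ hΨ, floquetAdjoint_floquetIsometry]

end FiberProjection

/-! ## Pointwise values and kernels -/

theorem inner_evalVec_bergmanSpace {D : Set ℂ} (hD : IsOpen D) {z : ℂ} (hz : z ∈ D) {f : L2 D}
    (hf : f ∈ bergmanSpace D) : inner ℂ (evalVec (bergmanSpace D) z) f = holoRep D f z :=
  have := completeSpace_bergmanSpace hD
  (evalVec_spec hD (bergmanSpace D) le_rfl hz).2 f hf

namespace IsCell

theorem evalVec_quasiSpace (hϖ : IsCell ϖ) (η : ℝ × ℝ) {x : ℂ} (hx : x ∈ ϖ) :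
    evalVec (quasiSpace ϖ η) x = cellProj ϖ η (evalVec (bergmanSpace ϖ) x) := by
  refine evalVec_eq hϖ.isOpen _ (quasiSpace_le_bergmanSpace hϖ η) hx
    (Submodule.starProjection_apply_mem _ _) fun f hf => ?_
  rw [cellProj, Submodule.inner_starProjection_left_eq_right,
    Submodule.starProjection_eq_self_iff.2 hf,
    inner_evalVec_bergmanSpace hϖ.isOpen hx (quasiSpace_le_bergmanSpace hϖ η hf)]

theorem memLp_cellKernel (hϖ : IsCell ϖ) (η : ℝ × ℝ) {x : ℂ} (hx : x ∈ ϖ) :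
    MemLp (cellKernel ϖ η x) 2 (volume.restrict ϖ) :=
  memLp_reproKernel hϖ.isOpen _ (quasiSpace_le_bergmanSpace hϖ η) hx

theorem holoRep_cellProj (hϖ : IsCell ϖ) (η : ℝ × ℝ) {x : ℂ} (hx : x ∈ ϖ) (f : L2 ϖ) :
    holoRep ϖ (cellProj ϖ η f) x = ∫ w in ϖ, cellKernel ϖ η x w * f w :=
  (integral_reproKernel hϖ.isOpen _ (quasiSpace_le_bergmanSpace hϖ η) hx f).symm

theorem holoRep_periodicDomain (hϖ : IsCell ϖ) {f : L2 (periodicDomain ϖ)}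
    (hf : f ∈ bergmanSpace (periodicDomain ϖ)) {z : ℂ} (hz : tr z ∈ ϖ) :
    holoRep (periodicDomain ϖ) f z =
      inner ℂ (evalVec (bergmanSpace ϖ) (tr z)) (cellPart ϖ (intPart z) f) := by
  obtain ⟨hdiff, hae⟩ := holoRep_spec (isOpen_periodicDomain ϖ) hf
  have hcell := hϖ.cellPart_ae_eq (intPart z) hae
  have hdiff' : DifferentiableOn ℂ
      (fun x => holoRep (periodicDomain ϖ) f (x + lat (intPart z))) ϖ :=
    hdiff.comp (by fun_prop) fun x hx => hϖ.add_lat_mem hx _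
  rw [inner_evalVec_bergmanSpace hϖ.isOpen hz (mem_bergmanSpace hdiff' hcell),
    holoRep_eq hϖ.isOpen hdiff' hcell hz, tr_add_lat_intPart]

theorem ae_inner_evalVec_eq_holoRep (hϖ : IsCell ϖ) {g : BochnerL2 ϖ} (hg : g ∈ fiberSpace ϖ)
    {x : ℂ} (hx : x ∈ ϖ) : ∀ᵐ η ∂floquetMeasure,
      inner ℂ (evalVec (bergmanSpace ϖ) x) (g η) = holoRep ϖ (g η) x := by
  have hfiber : ∀ᵐ η ∂floquetMeasure, g η ∈ quasiSpace ϖ η := hg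
  filter_upwards [hfiber] with η hη
  exact inner_evalVec_bergmanSpace hϖ.isOpen hx (quasiSpace_le_bergmanSpace hϖ η hη)

theorem integrable_exp_mul_holoRep (hϖ : IsCell ϖ) {g : BochnerL2 ϖ} (hg : g ∈ fiberSpace ϖ)
    {x : ℂ} (hx : x ∈ ϖ) (n : ℤ × ℤ) : Integrable
      (fun η => Complex.exp (Complex.I * pairing n η) * holoRep ϖ (g η) x) floquetMeasure := by
  refine (integrable_exp_smul ((integrable_bochnerL2 g).const_inner
    (evalVec (bergmanSpace ϖ) x)) n).congr ?_
  filter_upwards [hϖ.ae_inner_evalVec_eq_holoRep hg hx] with η hη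
  rw [hη, smul_eq_mul]

end IsCell

theorem inner_cellPart_floquetAdjoint (hϖ : IsTilingCell ϖ) (n : ℤ × ℤ) (k : L2 ϖ)
    (g : BochnerL2 ϖ) : inner ℂ k (cellPart ϖ n (floquetAdjoint hϖ g)) =
      1 / (2 * Real.pi) *
        ∫ η, Complex.exp (Complex.I * pairing n η) * inner ℂ k (g η) ∂floquetMeasure := by
  rw [cellPart_floquetAdjoint, inner_smul_right,
    ← integral_inner (integrable_exp_smul (integrable_bochnerL2 g) n)]
  simp only [inner_smul_right]

/-- The section `η ↦ exp(-i η·n) K_η(·, x)` of `A²_η`, obtained by projecting the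
corresponding section for the Bergman kernel of `ϖ`, which is trivially measurable in `η`. -/
def kernelSection (ϖ : Set ℂ) (n : ℤ × ℤ) (x : ℂ) : BochnerL2 ϖ :=
  (fiberSpace ϖ).starProjection (memLp_mode ϖ n (evalVec (bergmanSpace ϖ) x)).toLp

theorem kernelSection_mem_fiberSpace (ϖ : Set ℂ) (n : ℤ × ℤ) (x : ℂ) :
    kernelSection ϖ n x ∈ fiberSpace ϖ :=
  Submodule.starProjection_apply_mem _ _

section Kernel

variable (hϖ : IsTilingCell ϖ) {Ψ : ℂ → ℂ} {a : ℤ × ℤ → ℝ} (hΨ : IsDecayingPartition ϖ Ψ a)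

include hϖ hΨ

theorem holoRep_floquetAdjoint {g : BochnerL2 ϖ} (hg : g ∈ fiberSpace ϖ) {z : ℂ} (hz : tr z ∈ ϖ) :
    holoRep (periodicDomain ϖ) (floquetAdjoint hϖ g) z = 1 / (2 * Real.pi) *
      ∫ η, Complex.exp (Complex.I * pairing (intPart z) η) * holoRep ϖ (g η) (tr z)
        ∂floquetMeasure := by
  rw [hϖ.holoRep_periodicDomain (floquetAdjoint_mem_bergmanSpace hϖ hΨ hg) hz,
    inner_cellPart_floquetAdjoint]
  congr 1
  refine integral_congr_ae ?_
  filter_upwards [hϖ.ae_inner_evalVec_eq_holoRep hg hz] with η hη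
  rw [hη]

theorem integrable_exp_mul_holoRep_cellProj (g : BochnerL2 ϖ) {x : ℂ} (hx : x ∈ ϖ) (n : ℤ × ℤ) :
    Integrable (fun η => Complex.exp (Complex.I * pairing n η) *
      holoRep ϖ (cellProj ϖ η (g η)) x) floquetMeasure := by
  refine (hϖ.integrable_exp_mul_holoRep
    (Submodule.starProjection_apply_mem (fiberSpace ϖ) g) hx n).congr ?_
  filter_upwards [starProjection_fiberSpace_ae_eq hϖ hΨ g] with η hη
  rw [hη]

theorem holoRep_bergmanProj (f : L2 (periodicDomain ϖ)) {z : ℂ} (hz : tr z ∈ ϖ) :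
    holoRep (periodicDomain ϖ) (bergmanProj (periodicDomain ϖ) (isOpen_periodicDomain ϖ) f) z =
      1 / (2 * Real.pi) * ∫ η, Complex.exp (Complex.I * pairing (intPart z) η) *
        holoRep ϖ (cellProj ϖ η (floquet ϖ f η)) (tr z) ∂floquetMeasure := by
  rw [bergmanProj_eq_floquetAdjoint hϖ hΨ,
    holoRep_floquetAdjoint hϖ hΨ (Submodule.starProjection_apply_mem _ _) hz]
  congr 1
  refine integral_congr_ae ?_
  filter_upwards [starProjection_fiberSpace_ae_eq hϖ hΨ (floquetIsometry hϖ f)] with η hη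
  rw [hη, floquetIsometry_apply]

theorem floquet_bergmanProj (f : L2 (periodicDomain ϖ)) :
    floquet ϖ (bergmanProj (periodicDomain ϖ) (isOpen_periodicDomain ϖ) f) =
      fiberProj ϖ (floquet ϖ f) := by
  rw [← floquetIsometry_apply hϖ, ← floquetIsometry_apply hϖ,
    fiberProj_eq_starProjection hϖ hΨ, floquetIsometry_bergmanProj hϖ hΨ]

theorem bergmanProj_ae_eq_floquetInv (f : L2 (periodicDomain ϖ)) :
    bergmanProj (periodicDomain ϖ) (isOpen_periodicDomain ϖ) f
      =ᵐ[volume.restrict (periodicDomain ϖ)] floquetInv ϖ (fiberProj ϖ (floquet ϖ f)) := by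
  rw [← floquetIsometry_apply hϖ, fiberProj_eq_starProjection hϖ hΨ,
    bergmanProj_eq_floquetAdjoint hϖ hΨ]
  exact floquetAdjoint_ae_eq_floquetInv hϖ _

theorem kernelSection_ae_eq (n : ℤ × ℤ) {x : ℂ} (hx : x ∈ ϖ) :
    kernelSection ϖ n x =ᵐ[floquetMeasure] fun η =>
      Complex.exp (-(Complex.I * pairing n η)) • evalVec (quasiSpace ϖ η) x := by
  filter_upwards [starProjection_fiberSpace_ae_eq hϖ hΨ
    (memLp_mode ϖ n (evalVec (bergmanSpace ϖ) x)).toLp,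
    (memLp_mode ϖ n (evalVec (bergmanSpace ϖ) x)).coeFn_toLp] with η hproj hmode
  rw [kernelSection, hproj, hmode, map_smul, hϖ.evalVec_quasiSpace η hx]

theorem holoRep_kernelSection (n : ℤ × ℤ) {x y : ℂ} (hx : x ∈ ϖ) (hy : y ∈ ϖ) :
    ∀ᵐ η ∂floquetMeasure, holoRep ϖ (kernelSection ϖ n x η) y =
      Complex.exp (-(Complex.I * pairing n η)) * starRingEnd ℂ (cellKernel ϖ η x y) := by
  filter_upwards [kernelSection_ae_eq hϖ hΨ n hx, hϖ.ae_inner_evalVec_eq_holoRep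
    (kernelSection_mem_fiberSpace ϖ n x) hy] with η hsection hinner
  have hmem := (evalVec_spec hϖ.isOpen _ (quasiSpace_le_bergmanSpace hϖ.toIsCell η) hx).1
  rw [← hinner, hsection, inner_smul_right, inner_evalVec_bergmanSpace hϖ.isOpen hy
    (quasiSpace_le_bergmanSpace hϖ.toIsCell η hmem), cellKernel, reproKernel, Complex.conj_conj]

theorem integrable_cellKernel {x y : ℂ} (hx : x ∈ ϖ) (hy : y ∈ ϖ) :
    Integrable (fun η => cellKernel ϖ η x y) floquetMeasure := by
  have hint := hϖ.integrable_exp_mul_holoRep (kernelSection_mem_fiberSpace ϖ 0 x) hy 0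
  refine (Complex.conjCLE.toContinuousLinearMap.integrable_comp hint).congr ?_
  filter_upwards [holoRep_kernelSection hϖ hΨ 0 hx hy] with η hη
  simp [hη]

theorem evalVec_periodicDomain {z : ℂ} (hz : z ∈ periodicDomain ϖ) (hz' : tr z ∈ ϖ) :
    evalVec (bergmanSpace (periodicDomain ϖ)) z =
      (1 / (2 * Real.pi) : ℂ) • floquetAdjoint hϖ (kernelSection ϖ (intPart z) (tr z)) := by
  have := completeSpace_bergmanSpace (isOpen_periodicDomain ϖ)
  refine evalVec_eq (isOpen_periodicDomain ϖ) _ le_rfl hz (Submodule.smul_mem _ _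
    (floquetAdjoint_mem_bergmanSpace hϖ hΨ (kernelSection_mem_fiberSpace ϖ _ _))) fun f hf => ?_
  have hpart := inner_cellPart_floquetAdjoint hϖ (intPart z) (evalVec (bergmanSpace ϖ) (tr z))
    (floquetIsometry hϖ f)
  rw [floquetAdjoint_floquetIsometry] at hpart
  rw [inner_smul_left, ← inner_conj_symm, inner_floquetAdjoint, inner_conj_symm, kernelSection,
    Submodule.inner_starProjection_left_eq_right,
    Submodule.starProjection_eq_self_iff.2 (floquetIsometry_mem_fiberSpace hϖ hΨ hf), inner_mode,
    hϖ.holoRep_periodicDomain hf hz', hpart]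
  simp [map_ofNat]

theorem holoRep_evalVec_periodicDomain {z w : ℂ} (hz : z ∈ periodicDomain ϖ) (hz' : tr z ∈ ϖ)
    (hw : w ∈ periodicDomain ϖ) (hw' : tr w ∈ ϖ) :
    holoRep (periodicDomain ϖ) (evalVec (bergmanSpace (periodicDomain ϖ)) z) w =
      1 / (4 * Real.pi ^ 2) * ∫ η, Complex.exp (Complex.I * pairing (intPart w) η) *
        holoRep ϖ (kernelSection ϖ (intPart z) (tr z) η) (tr w) ∂floquetMeasure := by
  have hO := isOpen_periodicDomain ϖ
  have hmem := floquetAdjoint_mem_bergmanSpace hϖ hΨ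
    (kernelSection_mem_fiberSpace ϖ (intPart z) (tr z))
  rw [evalVec_periodicDomain hϖ hΨ hz hz',
    ← inner_evalVec_bergmanSpace hO hw (Submodule.smul_mem _ _ hmem), inner_smul_right,
    inner_evalVec_bergmanSpace hO hw hmem,
    holoRep_floquetAdjoint hϖ hΨ (kernelSection_mem_fiberSpace ϖ _ _) hw', ← mul_assoc]
  congr 1
  field_simp
  norm_num

theorem reproKernel_periodicDomain {z w : ℂ} (hz : z ∈ periodicDomain ϖ) (hz' : tr z ∈ ϖ)
    (hw : w ∈ periodicDomain ϖ) (hw' : tr w ∈ ϖ) :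
    reproKernel (bergmanSpace (periodicDomain ϖ)) z w = 1 / (4 * Real.pi ^ 2) *
      ∫ η, Complex.exp (Complex.I * pairing (intPart z - intPart w) η) *
        cellKernel ϖ η (tr z) (tr w) ∂floquetMeasure := by
  rw [reproKernel, holoRep_evalVec_periodicDomain hϖ hΨ hz hz' hw hw', map_mul, ← integral_conj]
  congr 1
  · simp [map_ofNat]
  · refine integral_congr_ae ?_
    filter_upwards [holoRep_kernelSection hϖ hΨ (intPart z) hz' hw'] with η hη
    rw [hη, ← mul_assoc, ← Complex.exp_add, map_mul, Complex.conj_conj, ← Complex.exp_conj,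
      sub_eq_add_neg (intPart z), pairing_add, pairing_neg]
    congr 2
    simp
    ring

theorem ae_integral_cellKernel_eq {z : ℂ} (hz : z ∈ periodicDomain ϖ) (hz' : tr z ∈ ϖ) :
    ∀ᵐ w ∂(volume.restrict (periodicDomain ϖ)),
      ∫ η, Complex.exp (Complex.I * pairing (intPart z - intPart w) η) *
        cellKernel ϖ η (tr z) (tr w) ∂floquetMeasure =
      4 * Real.pi ^ 2 * reproKernel (bergmanSpace (periodicDomain ϖ)) z w := by
  filter_upwards [hϖ.ae_tr_mem,
    ae_restrict_mem (isOpen_periodicDomain ϖ).measurableSet] with w hw' hw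
  have hpi : (Real.pi : ℂ) ≠ 0 := Complex.ofReal_ne_zero.2 Real.pi_ne_zero
  rw [reproKernel_periodicDomain hϖ hΨ hz hz' hw hw']
  field_simp

theorem memLp_integral_cellKernel {z : ℂ} (hz : z ∈ periodicDomain ϖ) (hz' : tr z ∈ ϖ) :
    MemLp (fun w => ∫ η, Complex.exp (Complex.I * pairing (intPart z - intPart w) η) *
      cellKernel ϖ η (tr z) (tr w) ∂floquetMeasure) 2 (volume.restrict (periodicDomain ϖ)) :=
  have := completeSpace_bergmanSpace (isOpen_periodicDomain ϖ)
  ((memLp_reproKernel (isOpen_periodicDomain ϖ) _ le_rfl hz).const_mul (4 * Real.pi ^ 2 : ℂ)).ae_eq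
    (EventuallyEq.symm (ae_integral_cellKernel_eq hϖ hΨ hz hz'))

theorem holoRep_bergmanProj_eq_integral_cellKernel (f : L2 (periodicDomain ϖ)) {z : ℂ}
    (hz : z ∈ periodicDomain ϖ) (hz' : tr z ∈ ϖ) :
    holoRep (periodicDomain ϖ) (bergmanProj (periodicDomain ϖ) (isOpen_periodicDomain ϖ) f) z =
      1 / (4 * Real.pi ^ 2) * ∫ w in periodicDomain ϖ, ∫ η,
        Complex.exp (Complex.I * pairing (intPart z - intPart w) η) *
          cellKernel ϖ η (tr z) (tr w) * f w ∂floquetMeasure := by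
  have := completeSpace_bergmanSpace (isOpen_periodicDomain ϖ)
  have hrepro : holoRep (periodicDomain ϖ)
      (bergmanProj (periodicDomain ϖ) (isOpen_periodicDomain ϖ) f) z =
      ∫ w in periodicDomain ϖ, reproKernel (bergmanSpace (periodicDomain ϖ)) z w * f w :=
    (integral_reproKernel (isOpen_periodicDomain ϖ) _ le_rfl hz f).symm
  rw [hrepro, ← integral_const_mul]
  refine integral_congr_ae ?_
  filter_upwards [ae_integral_cellKernel_eq hϖ hΨ hz hz'] with w hw
  have hpi : (Real.pi : ℂ) ≠ 0 := Complex.ofReal_ne_zero.2 Real.pi_ne_zero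
  rw [integral_mul_const, hw]
  field_simp

end Kernel

end FloquetBergman

end

theorem theorem4p1_general (ϖ : Set ℂ) (hϖ : IsTilingCell ϖ) {Ψ : ℂ → ℂ} {a : ℤ × ℤ → ℝ}
    (hΨ : IsDecayingPartition ϖ Ψ a) :
    ((∀ g : BochnerL2 ϖ, MemLp (fun η => cellProj ϖ η (g η)) 2 floquetMeasure) ∧
      ∀ g : BochnerL2 ϖ, fiberProj ϖ g = (fiberSpace ϖ).starProjection g) ∧
    (∀ η ∈ floquetSquare, ∀ z ∈ ϖ, MemLp (cellKernel ϖ η z) 2 (volume.restrict ϖ) ∧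
      ∀ f : L2 ϖ, holoRep ϖ (cellProj ϖ η f) z = ∫ w in ϖ, cellKernel ϖ η z w * f w) ∧
    (∀ f : L2 (periodicDomain ϖ),
      floquet ϖ (bergmanProj (periodicDomain ϖ) (isOpen_periodicDomain ϖ) f)
        = fiberProj ϖ (floquet ϖ f) ∧
      bergmanProj (periodicDomain ϖ) (isOpen_periodicDomain ϖ) f
        =ᵐ[volume.restrict (periodicDomain ϖ)] floquetInv ϖ (fiberProj ϖ (floquet ϖ f))) ∧
    (∀ f : L2 (periodicDomain ϖ), ∀ z ∈ periodicDomain ϖ, tr z ∈ ϖ →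
      Integrable (fun η => Complex.exp (Complex.I * pairing (intPart z) η) *
        holoRep ϖ (cellProj ϖ η (floquet ϖ f η)) (tr z)) floquetMeasure ∧
      holoRep (periodicDomain ϖ)
          (bergmanProj (periodicDomain ϖ) (isOpen_periodicDomain ϖ) f) z
        = 1 / (2 * Real.pi) * ∫ η, Complex.exp (Complex.I * pairing (intPart z) η) *
            holoRep ϖ (cellProj ϖ η (floquet ϖ f η)) (tr z) ∂floquetMeasure) ∧
    (∀ z ∈ periodicDomain ϖ, tr z ∈ ϖ →
      (∀ w ∈ periodicDomain ϖ, tr w ∈ ϖ →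
        Integrable (fun η => cellKernel ϖ η (tr z) (tr w)) floquetMeasure) ∧
      MemLp (fun w => ∫ η, Complex.exp (Complex.I * pairing (intPart z - intPart w) η) *
        cellKernel ϖ η (tr z) (tr w) ∂floquetMeasure) 2 (volume.restrict (periodicDomain ϖ)) ∧
      (∀ f : L2 (periodicDomain ϖ),
        holoRep (periodicDomain ϖ)
            (bergmanProj (periodicDomain ϖ) (isOpen_periodicDomain ϖ) f) z
          = 1 / (4 * Real.pi ^ 2) * ∫ w in periodicDomain ϖ, ∫ η,
              Complex.exp (Complex.I * pairing (intPart z - intPart w) η) *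
                cellKernel ϖ η (tr z) (tr w) * f w ∂floquetMeasure) ∧
      (∀ w ∈ periodicDomain ϖ, tr w ∈ ϖ →
        reproKernel (bergmanSpace (periodicDomain ϖ)) z w
          = 1 / (4 * Real.pi ^ 2) * ∫ η,
              Complex.exp (Complex.I * pairing (intPart z - intPart w) η) *
                cellKernel ϖ η (tr z) (tr w) ∂floquetMeasure)) :=
  ⟨⟨memLp_cellProj hϖ hΨ, fiberProj_eq_starProjection hϖ hΨ⟩,
    fun η _ _ hz => ⟨hϖ.memLp_cellKernel η hz, hϖ.holoRep_cellProj η hz⟩,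
    fun f => ⟨floquet_bergmanProj hϖ hΨ f, bergmanProj_ae_eq_floquetInv hϖ hΨ f⟩,
    fun f z _ hz => ⟨integrable_exp_mul_holoRep_cellProj hϖ hΨ (floquet ϖ f) hz (intPart z),
      holoRep_bergmanProj hϖ hΨ f hz⟩,
    fun _ hz hz' => ⟨fun _ _ hw' => integrable_cellKernel hϖ hΨ hz' hw',
      memLp_integral_cellKernel hϖ hΨ hz hz',
      fun f => holoRep_bergmanProj_eq_integral_cellKernel hϖ hΨ f hz hz',
      fun _ hw hw' => reproKernel_periodicDomain hϖ hΨ hz hz' hw hw'⟩⟩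

theorem theorem4p1 (ϖ : Set ℂ) (hϖ : IsPeriodicCell ϖ) (hA : ConditionA ϖ)
    -- up to a null set, the periodic domain is the union of the translated cells
    (hnull : volume (periodicDomain ϖ \ ⋃ m, cellTranslate ϖ m) = 0) :
    -- (i) the fibrewise operator is well defined and is the orthogonal projection
    ((∀ g : BochnerL2 ϖ, MemLp (fun η => cellProj ϖ η (g η)) 2 floquetMeasure) ∧
      ∀ g : BochnerL2 ϖ, fiberProj ϖ g = (fiberSpace ϖ).starProjection g) ∧
    -- the functions `K_η` are the kernels of the projections `P_η`
    (∀ η ∈ floquetSquare, ∀ z ∈ ϖ, MemLp (cellKernel ϖ η z) 2 (volume.restrict ϖ) ∧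
      ∀ f : L2 ϖ, holoRep ϖ (cellProj ϖ η f) z = ∫ w in ϖ, cellKernel ϖ η z w * f w) ∧
    -- (ii) the Bergman projection is `F⁻¹ 𝒫 F`
    (∀ f : L2 (periodicDomain ϖ),
      floquet ϖ (bergmanProj (periodicDomain ϖ) (isOpen_periodicDomain ϖ) f)
        = fiberProj ϖ (floquet ϖ f) ∧
      bergmanProj (periodicDomain ϖ) (isOpen_periodicDomain ϖ) f
        =ᵐ[volume.restrict (periodicDomain ϖ)] floquetInv ϖ (fiberProj ϖ (floquet ϖ f))) ∧
    -- the pointwise formula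
    (∀ f : L2 (periodicDomain ϖ), ∀ z ∈ periodicDomain ϖ, tr z ∈ ϖ →
      Integrable (fun η => Complex.exp (Complex.I * pairing (intPart z) η) *
        holoRep ϖ (cellProj ϖ η (floquet ϖ f η)) (tr z)) floquetMeasure ∧
      holoRep (periodicDomain ϖ)
          (bergmanProj (periodicDomain ϖ) (isOpen_periodicDomain ϖ) f) z
        = 1 / (2 * Real.pi) * ∫ η, Complex.exp (Complex.I * pairing (intPart z) η) *
            holoRep ϖ (cellProj ϖ η (floquet ϖ f η)) (tr z) ∂floquetMeasure) ∧
    -- the kernel formula; the inner integral over `η` is computed first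
    (∀ z ∈ periodicDomain ϖ, tr z ∈ ϖ →
      (∀ w ∈ periodicDomain ϖ, tr w ∈ ϖ →
        Integrable (fun η => cellKernel ϖ η (tr z) (tr w)) floquetMeasure) ∧
      MemLp (fun w => ∫ η, Complex.exp (Complex.I * pairing (intPart z - intPart w) η) *
        cellKernel ϖ η (tr z) (tr w) ∂floquetMeasure) 2 (volume.restrict (periodicDomain ϖ)) ∧
      (∀ f : L2 (periodicDomain ϖ),
        holoRep (periodicDomain ϖ)
            (bergmanProj (periodicDomain ϖ) (isOpen_periodicDomain ϖ) f) z
          = 1 / (4 * Real.pi ^ 2) * ∫ w in periodicDomain ϖ, ∫ η,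
              Complex.exp (Complex.I * pairing (intPart z - intPart w) η) *
                cellKernel ϖ η (tr z) (tr w) * f w ∂floquetMeasure) ∧
      (∀ w ∈ periodicDomain ϖ, tr w ∈ ϖ →
        reproKernel (bergmanSpace (periodicDomain ϖ)) z w
          = 1 / (4 * Real.pi ^ 2) * ∫ η,
              Complex.exp (Complex.I * pairing (intPart z - intPart w) η) *
                cellKernel ϖ η (tr z) (tr w) ∂floquetMeasure)) := by
  obtain ⟨Ψ, a, hΨ⟩ := hA.exists_isDecayingPartition (hϖ.isTilingCell hnull)
  exact theorem4p1_general ϖ (hϖ.isTilingCell hnull) hΨ
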